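/- Let $k\ge 1$ and $d\ge k+1$. Write $|\cdot|$ for Lebesgue measure on $\mathbb R^d$, $Q_L=[-L/2,L/2]^d$, and let $\mu$ be the Haar probability measure on $SO(d)$. A measurable set $A\subseteq[0,1]^d$ is \emph{$(\varepsilon,L)$-uniformly distributed} if $$\int_{[0,1]^d}\left|\frac{|A\cap(t+Q_L)|}{|Q_L|}-|A|\right|^2dt\le\varepsilon^2 .$$ For linearly independent $v_1,\dots,v_k\in\mathbb R^d$ let $\Delta_k=\{0,v_1,\dots,v_k\}$ (a non-degenerate $k$-dimensional simplex) and $$c_{\Delta_k}=\min_{1\le j\le k}\operatorname{dist}\bigl(v_j,\operatorname{span}\{v_i: i\ne j\}\bigr).$$ A set contains an isometric copy of $\lambda\cdot\Delta_k$ if it contains $x+\lambda\, U(\Delta_k)$ for some $x\in\mathbb R^d$ and $U\in SO(d)$. (1) There is a constant $C>0$ depending only on $k$ and $d$, and for every $R>0$ there is an $\varepsilon_0>0$ depending only on $k$, $d$ and $R$, such that the following holds for every non-degenerate simplex $\Delta_k=\{0,v_1,\dots,v_k\}$ with $c_{\Delta_k}\le1$ and $|v_j|\le R$ for all $j$. Let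 $0<\lambda\le\varepsilon\le\varepsilon_0$ and let $A\subseteq[0,1]^d$ be measurable with $\alpha=|A|>0$. If $A$ is $(\varepsilon,\varepsilon^4\lambda)$-uniformly distributed, then $$\left|\int_{\mathbb R^d}\int_{SO(d)}1_A(x)\,1_A(x-\lambda\, U v_1)\cdots1_A(x-\lambda\, U v_k)\,d\mu(U)\,dx-\alpha^{k+1}\right|\le C\,c_{\Delta_k}^{-1/6}\varepsilon^{2/3},$$ and if moreover $C\,c_{\Delta_k}^{-1/6}\varepsilon^{2/3}<\alpha^{k+1}$, then $A$ contains an isometric copy of $\lambda\cdot\Delta_k$. (2) (Bourgain) Let $\Delta_k=\{0,v_1,\dots,v_k\}$ be a non-degenerate $k$-dimensional simplex. If a measurable set $A\subseteq\mathbb R^d$ has positive upper Banach density, $$\delta^*(A)=\lim_{N\to\infty}\sup_{t\in\mathbb R^d}\frac{|A\cap(t+Q_N)|}{|Q_N|}>0,$$ then there is a $\lambda_0=\lambda_0(A,\Delta_k)>0$ such that $A$ contains an isometric copy of $\lambda\cdot\Delta_k$ for all $\lambda\ge\lambda_0$. -/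

import Mathlib

open MeasureTheory Filter Set
open scoped ENNReal Topology

noncomputable section

namespace Simplices

/-- `ℝ^d` with its Euclidean norm and Lebesgue measure. -/
abbrev E (d : ℕ) : Type := EuclideanSpace ℝ (Fin d)

/-- The unit cube `[0,1]^d`. -/
def unitCube (d : ℕ) : Set (E d) := {x | ∀ i, 0 ≤ x i ∧ x i ≤ 1}

/-- The cube `t + Q_L`, where `Q_L = [-L/2, L/2]^d`. -/
def cube {d : ℕ} (t : E d) (L : ℝ) : Set (E d) := {x | ∀ i, |x i - t i| ≤ L / 2}

/-- The inequality defining `(ε, L)`-uniform distribution of a set `A ⊆ [0,1]^d`. -/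
def IsUniformlyDistributed {d : ℕ} (ε L : ℝ) (A : Set (E d)) : Prop :=
  A ⊆ unitCube d ∧
    ∫ t in unitCube d,
      |volume.real (A ∩ cube t L) / volume.real (cube (0 : E d) L) - volume.real A| ^ 2 ≤ ε ^ 2

/-- Upper Banach density. The limit in `N` exists for measurable sets, so that it is the
upper limit. -/
def upperBanachDensity {d : ℕ} (A : Set (E d)) : ℝ≥0∞ :=
  limsup (fun N : ℝ => ⨆ t : E d, volume (A ∩ cube t N) / volume (cube (0 : E d) N)) atTop

/-- The rotation group `SO(d)`. -/
abbrev SO (d : ℕ) : Type := Matrix.specialOrthogonalGroup (Fin d) ℝ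

instance (d : ℕ) : IsTopologicalGroup (SO d) where
  continuous_mul := by
    refine continuous_induced_rng.mpr ?_
    exact (continuous_subtype_val.comp continuous_fst).mul
      (continuous_subtype_val.comp continuous_snd)
  continuous_inv := by
    refine continuous_induced_rng.mpr ?_
    exact (continuous_subtype_val (p := fun M => M ∈ Matrix.specialOrthogonalGroup (Fin d) ℝ)).star

instance (d : ℕ) : CompactSpace (SO d) := by
  refine isCompact_iff_compactSpace.mp ?_
  have hK : IsCompact (Set.pi univ fun _ : Fin d => Set.pi univ fun _ : Fin d => Icc (-1 : ℝ) 1) :=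
    isCompact_univ_pi fun _ => isCompact_univ_pi fun _ => isCompact_Icc
  refine IsCompact.of_isClosed_subset (X := Matrix (Fin d) (Fin d) ℝ) hK ?_ ?_
  · have h : (Matrix.specialOrthogonalGroup (Fin d) ℝ : Set (Matrix (Fin d) (Fin d) ℝ)) =
        {M | M * M.transpose = 1} ∩ {M | M.det = 1} := by
      ext M
      exact and_congr (Matrix.mem_orthogonalGroup_iff (Fin d) ℝ) Iff.rfl
    rw [h]
    exact (isClosed_eq (by fun_prop) continuous_const).inter
      (isClosed_eq (by fun_prop) continuous_const)
  · intro M hM i _ j _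
    have h := entry_norm_bound_of_unitary (𝕜 := ℝ) (U := M) hM.1 i j
    exact abs_le.mp h

/-- The Borel `σ`-algebra of `SO(d)`. -/
instance (d : ℕ) : MeasurableSpace (SO d) := borel _

instance (d : ℕ) : BorelSpace (SO d) := ⟨rfl⟩

/-- The Haar probability measure on `SO(d)`. -/
def haarSO (d : ℕ) : Measure (SO d) := Measure.haarMeasure ⊤

/-- The action of `SO(d)` on `ℝ^d`. -/
def rot {d : ℕ} (U : SO d) (v : E d) : E d := Matrix.toEuclideanLin U.1 v

/-- The vertex set `{0, v_1, …, v_k}`. -/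
def simplex {d k : ℕ} (v : Fin k → E d) : Set (E d) := insert 0 (range v)

/-- `c_Δ = min_j dist (v_j, span {v_i : i ≠ j})`. -/
def simplexWidth {d k : ℕ} (v : Fin k → E d) : ℝ :=
  ⨅ j : Fin k, Metric.infDist (v j) (Submodule.span ℝ (v '' {j}ᶜ) : Set (E d))

/-- `A` contains a set `x + l · U(Δ)` with `x ∈ ℝ^d` and `U ∈ SO(d)`. -/
def ContainsCopy {d : ℕ} (A : Set (E d)) (l : ℝ) (Δ : Set (E d)) : Prop :=
  ∃ (x : E d) (U : SO d), (fun p => x + l • rot U p) '' Δ ⊆ A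

/-- `∬ 1_A(x) 1_A(x - l U v_1) ⋯ 1_A(x - l U v_k) dμ(U) dx`. -/
def simplexCount {d k : ℕ} (A : Set (E d)) (v : Fin k → E d) (l : ℝ) : ℝ :=
  ∫ x : E d, ∫ U : SO d,
    A.indicator (fun _ => (1 : ℝ)) x *
      ∏ j : Fin k, A.indicator (fun _ => (1 : ℝ)) (x - l • rot U (v j)) ∂(haarSO d)

end Simplices

end

/-!
The count `∬ 1_A(x) ∏ 1_A(x - λ U v_j)` is compared with `|A|^(k+1)` by replacing the functions
`1_A` at the vertices `v_j` one at a time by `|A| 1_{[0,1]^d}`. Each replacement costs a multilinear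
form with the balanced function `f = 1_A - |A| 1_{[0,1]^d}` at one vertex `v_j`. Since `k < d`,
there is a circle of rotations that fix the other vertices and move `v_j` along a circle of diameter
at least `2 c_Δ`, so by Cauchy-Schwarz the square of that form is at most the average of the
autocorrelation of `f` over the randomly rotated chords of a circle of diameter at least `2 λ c_Δ`.

The lengths of these chords vary, so the average is one of spherical means over a range of radii,
like an average over solid balls; an integration by parts in the radius shows that it changes little
when the autocorrelation is translated by a vector that is short compared with `λ c_Δ`. This takes
the place of Fourier decay. One may therefore first average `f` over cubes of side `L`, and the
result is small in `L²` exactly when `A` is uniformly distributed at scale `L`.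

For a set of positive upper Banach density, choose a huge cube in which the density is nearly
extremal. No smaller cube, as long as it is still large, can be much denser, and densities that
average to their near maximum are nearly constant: rescaled to the unit cube, the set is uniformly
distributed.
-/

noncomputable section

namespace Simplices

/-! ### Rotations and Haar measure -/

section Rotations

variable {d : ℕ}

theorem rot_sub (U : SO d) (x y : E d) : rot U (x - y) = rot U x - rot U y :=
  map_sub _ x y

theorem rot_neg (U : SO d) (x : E d) : rot U (-x) = -rot U x :=
  map_neg _ x

theorem rot_smul (U : SO d) (a : ℝ) (x : E d) : rot U (a • x) = a • rot U x :=
  map_smul _ a x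

theorem rot_mul (U V : SO d) (x : E d) : rot (U * V) x = rot U (rot V x) := by
  simp [rot]

@[fun_prop]
theorem continuous_rot {X : Type*} [TopologicalSpace X] {U : X → SO d} {x : X → E d}
    (hU : Continuous U) (hx : Continuous x) : Continuous fun p => rot (U p) (x p) := by
  simp only [rot, Matrix.toLpLin_apply]
  fun_prop

theorem norm_rot (U : SO d) (x : E d) : ‖rot U x‖ = ‖x‖ := by
  have hU : U.1.transpose * U.1 = 1 := (Matrix.mem_orthogonalGroup_iff' (Fin d) ℝ).1 U.2.1
  have hinner : inner ℝ (rot U x) (rot U x) = inner ℝ x x := by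
    rw [EuclideanSpace.inner_eq_star_dotProduct, EuclideanSpace.inner_eq_star_dotProduct]
    simp only [rot, Matrix.toLpLin_apply, star_trivial]
    rw [Matrix.dotProduct_mulVec, ← Matrix.mulVec_transpose, Matrix.mulVec_mulVec, hU,
      Matrix.one_mulVec]
  rw [norm_eq_sqrt_real_inner, hinner, ← norm_eq_sqrt_real_inner]

/-- The action of an element of `SO(d)` as a linear isometry equivalence. -/
def rotIsometry (U : SO d) : E d ≃ₗᵢ[ℝ] E d :=
  LinearIsometry.toLinearIsometryEquiv ⟨Matrix.toEuclideanLin U.1, norm_rot U⟩ rfl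

theorem measurePreserving_rot (U : SO d) : MeasurePreserving (rot U) :=
  (rotIsometry U).measurePreserving

theorem measurableEmbedding_rot (U : SO d) : MeasurableEmbedding (rot U) :=
  (rotIsometry U).toHomeomorph.measurableEmbedding

theorem exists_rot_eq_of_det_eq_one (f : E d ≃ₗᵢ[ℝ] E d)
    (hf : LinearMap.det (f.toLinearEquiv : E d →ₗ[ℝ] E d) = 1) :
    ∃ U : SO d, ∀ x, rot U x = f x := by
  let b := EuclideanSpace.basisFun (Fin d) ℝ
  refine ⟨⟨LinearMap.toMatrix b.toBasis b.toBasis (f.toLinearEquiv : E d →ₗ[ℝ] E d),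
    f.toMatrix_mem_unitaryGroup b b, (LinearMap.det_toMatrix _ _).trans hf⟩, fun x => ?_⟩
  rw [rot, Matrix.toEuclideanLin_eq_toLin_orthonormal, Matrix.toLin_toMatrix]
  rfl

theorem det_linearIsometryEquiv_eq_one_or (f : E d ≃ₗᵢ[ℝ] E d) :
    LinearMap.det (f.toLinearEquiv : E d →ₗ[ℝ] E d) = 1 ∨
      LinearMap.det (f.toLinearEquiv : E d →ₗ[ℝ] E d) = -1 := by
  let b := EuclideanSpace.basisFun (Fin d) ℝ
  have hdet := congrArg Matrix.det ((Matrix.mem_orthogonalGroup_iff (Fin d) ℝ).1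
    (f.toMatrix_mem_unitaryGroup b b))
  rw [Matrix.det_mul, Matrix.det_one, Matrix.det_transpose] at hdet
  rw [← LinearMap.det_toMatrix b.toBasis]
  exact mul_self_eq_one_iff.1 hdet

theorem exists_norm_eq_one_mem_orthogonal (S : Submodule ℝ (E d))
    (hS : Module.finrank ℝ S < d) : ∃ e ∈ Sᗮ, ‖e‖ = 1 := by
  have hne : Sᗮ ≠ ⊥ := by
    intro h
    have := Submodule.finrank_add_finrank_orthogonal S
    rw [h, finrank_bot, finrank_euclideanSpace_fin] at this
    omega
  obtain ⟨y, hy, hy0⟩ := Submodule.exists_mem_ne_zero_of_ne_bot hne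
  exact ⟨‖y‖⁻¹ • y, Sᗮ.smul_mem _ hy, norm_smul_inv_norm hy0⟩

-- If `f` reverses orientation, precompose it with the reflection in a hyperplane containing `S`.
theorem exists_rot_eqOn (f : E d ≃ₗᵢ[ℝ] E d) (S : Submodule ℝ (E d))
    (hS : Module.finrank ℝ S < d) : ∃ U : SO d, EqOn (rot U) f S := by
  rcases det_linearIsometryEquiv_eq_one_or f with hf | hf
  · obtain ⟨U, hU⟩ := exists_rot_eq_of_det_eq_one f hf
    exact ⟨U, fun x _ => hU x⟩
  obtain ⟨e, heS, he⟩ := exists_norm_eq_one_mem_orthogonal S hS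
  have he0 : e ≠ 0 := norm_ne_zero_iff.1 (he ▸ one_ne_zero)
  let K : Submodule ℝ (E d) := (ℝ ∙ e)ᗮ
  have hK : LinearMap.det (K.reflection.toLinearEquiv : E d →ₗ[ℝ] E d) = -1 := by
    rw [Submodule.det_reflection, Submodule.orthogonal_orthogonal, finrank_span_singleton he0,
      pow_one]
  obtain ⟨U, hU⟩ := exists_rot_eq_of_det_eq_one (K.reflection.trans f) <| by
    change LinearMap.det ((f.toLinearEquiv : E d →ₗ[ℝ] E d) ∘ₗ
      (K.reflection.toLinearEquiv : E d →ₗ[ℝ] E d)) = 1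
    rw [LinearMap.det_comp, hf, hK, neg_one_mul, neg_neg]
  refine ⟨U, fun x hx => ?_⟩
  have hxK : x ∈ K := Submodule.mem_orthogonal_singleton_iff_inner_left.2 (heS x hx)
  rw [hU, LinearIsometryEquiv.trans_apply, Submodule.reflection_mem_subspace_eq_self hxK]

theorem finrank_span_range_le {k : ℕ} (v : Fin k → E d) :
    Module.finrank ℝ (Submodule.span ℝ (range v)) ≤ k := by
  simpa only [Fintype.card_fin, Set.finrank] using finrank_range_le_card (R := ℝ) v

theorem exists_rot_eq_of_norm_eq (hd : 2 ≤ d) {x y : E d} (h : ‖x‖ = ‖y‖) :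
    ∃ U : SO d, rot U x = y := by
  obtain ⟨U, hU⟩ := exists_rot_eqOn (ℝ ∙ (x - y))ᗮ.reflection
    (Submodule.span ℝ (range fun _ : Fin 1 => x)) ((finrank_span_range_le _).trans_lt hd)
  exact ⟨U, (hU (Submodule.subset_span (mem_range_self 0))).trans (Submodule.reflection_sub h)⟩

theorem exists_rot_eq_neg {k : ℕ} (hd : k + 1 ≤ d) (v : Fin k → E d) :
    ∃ S : SO d, ∀ j, rot S (v j) = -v j := by
  obtain ⟨S, hS⟩ := exists_rot_eqOn (LinearIsometryEquiv.neg ℝ) (Submodule.span ℝ (range v))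
    ((finrank_span_range_le v).trans_lt hd)
  exact ⟨S, fun j => hS (Submodule.subset_span (mem_range_self j))⟩

instance (d : ℕ) : IsProbabilityMeasure (haarSO d) :=
  ⟨Measure.haarMeasure_self (K₀ := (⊤ : TopologicalSpace.PositiveCompacts (SO d)))⟩

instance (d : ℕ) : (haarSO d).IsHaarMeasure :=
  inferInstanceAs (Measure.haarMeasure _).IsHaarMeasure

instance (d : ℕ) : (haarSO d).IsMulRightInvariant where
  map_mul_right_eq_self g :=
    have := Measure.isProbabilityMeasure_map (μ := haarSO d) (measurable_mul_const g).aemeasurable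
    Measure.isHaarMeasure_eq_of_isProbabilityMeasure _ _

instance (d : ℕ) : SecondCountableTopology (SO d) :=
  haveI : SecondCountableTopology (Matrix (Fin d) (Fin d) ℝ) :=
    inferInstanceAs (SecondCountableTopology (Fin d → Fin d → ℝ))
  (Topology.IsInducing.subtypeVal
    (t := {M | M ∈ Matrix.specialOrthogonalGroup (Fin d) ℝ})).secondCountableTopology

end Rotations

/-! ### Means over spheres and chords -/

section Balls

variable {V : Type*} [NormedAddCommGroup V] [NormedSpace ℝ V] [FiniteDimensional ℝ V]
  [MeasurableSpace V] [BorelSpace V] (μ : Measure V) [μ.IsAddHaarMeasure]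

theorem measureReal_ball_of_pos (c : V) {r : ℝ} (hr : 0 < r) :
    μ.real (Metric.ball c r) = r ^ Module.finrank ℝ V * μ.real (Metric.ball 0 1) := by
  rw [Measure.real, Measure.addHaar_ball_of_pos _ _ hr, ENNReal.toReal_mul,
    ENNReal.toReal_ofReal (by positivity), Measure.real]

theorem setIntegral_ball_fun_norm [Nontrivial V] (N : ℝ → ℝ) {s : ℝ} (hs : 0 ≤ s) :
    ∫ x in Metric.ball (0 : V) s, N ‖x‖ ∂μ = Module.finrank ℝ V * μ.real (Metric.ball 0 1) *
      ∫ u in (0 : ℝ)..s, u ^ (Module.finrank ℝ V - 1) * N u := by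
  have hball : (Metric.ball (0 : V) s).indicator (fun x => N ‖x‖) =
      fun x => (Iio s).indicator N ‖x‖ := by
    ext x
    simp [indicator]
  have hIoo (u : ℝ) : (Ioi (0 : ℝ)).indicator
      (fun u => u ^ (Module.finrank ℝ V - 1) * (Iio s).indicator N u) u =
      (Ioo 0 s).indicator (fun u => u ^ (Module.finrank ℝ V - 1) * N u) u := by
    by_cases h0 : 0 < u <;> by_cases h1 : u < s <;> simp [indicator, h0, h1]
  rw [← integral_indicator measurableSet_ball, hball, integral_fun_norm_addHaar,
    intervalIntegral.integral_of_le hs, integral_Ioc_eq_integral_Ioo,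
    ← integral_indicator measurableSet_Ioi, ← integral_indicator measurableSet_Ioo]
  simp only [smul_eq_mul, nsmul_eq_mul, hIoo, mul_assoc]

-- Both balls lie in the ball of radius `s + ‖h‖` about `0` and miss only a thin part of it.
theorem abs_setIntegral_ball_sub_comp_add_le {F : V → ℝ} {M : ℝ} (hF : LocallyIntegrable F μ)
    (hM : ∀ x, |F x| ≤ M) (h : V) {s : ℝ} (hs : 0 < s) :
    |∫ x in Metric.ball (0 : V) s, (F x - F (x + h)) ∂μ| ≤
      2 * M * (((s + ‖h‖) ^ Module.finrank ℝ V - s ^ Module.finrank ℝ V) *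
        μ.real (Metric.ball 0 1)) := by
  have hint (c : V) (r : ℝ) : IntegrableOn F (Metric.ball c r) μ :=
    (hF.integrableOn_isCompact (isCompact_closedBall c r)).mono_set Metric.ball_subset_closedBall
  have hpre : (· + h) ⁻¹' Metric.ball h s = Metric.ball (0 : V) s := by
    ext x
    simp [dist_eq_norm]
  have hshift_int : IntegrableOn (fun x => F (x + h)) (Metric.ball 0 s) μ := by
    rw [← hpre]
    exact ((measurePreserving_add_right μ h).integrableOn_comp_preimage
      (measurableEmbedding_addRight h)).2 (hint h s)
  have hshift : ∫ x in Metric.ball (0 : V) s, F (x + h) ∂μ = ∫ x in Metric.ball h s, F x ∂μ := by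
    rw [← hpre]
    exact (measurePreserving_add_right μ h).setIntegral_preimage_emb
      (measurableEmbedding_addRight h) F (Metric.ball h s)
  rw [integral_sub (hint 0 s) hshift_int, hshift]
  let B := Metric.ball (0 : V) (s + ‖h‖)
  have hdiff (c : V) (hc : Metric.ball c s ⊆ B) :
      |(∫ x in B, F x ∂μ) - ∫ x in Metric.ball c s, F x ∂μ| ≤
        M * (((s + ‖h‖) ^ Module.finrank ℝ V - s ^ Module.finrank ℝ V) *
          μ.real (Metric.ball 0 1)) := by
    rw [← setIntegral_sdiff measurableSet_ball (hint _ _) hc, sub_mul,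
      ← measureReal_ball_of_pos μ 0 (by positivity : 0 < s + ‖h‖), ← measureReal_ball_of_pos μ c hs,
      ← measureReal_sdiff hc measurableSet_ball measure_ball_lt_top.ne]
    exact norm_setIntegral_le_of_norm_le_const (f := F)
      ((measure_mono sdiff_subset).trans_lt measure_ball_lt_top) fun x _ => hM x
  have h0 := abs_le.1 <| hdiff 0 (Metric.ball_subset_ball (by linarith [norm_nonneg h]))
  have h1 := abs_le.1 <| hdiff h (Metric.ball_subset_ball' (by simp))
  exact abs_le.2 ⟨by linarith, by linarith⟩

end Balls

section SphereMeans

variable {d : ℕ} {F : E d → ℝ}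

/-- The mean of `F` over the orbit of `x` under `SO(d)`, which is the sphere about `0` through `x`
as soon as `2 ≤ d`. -/
def sphereMean (F : E d → ℝ) (x : E d) : ℝ := ∫ U, F (rot U x) ∂haarSO d

theorem sphereMean_congr_norm (hd : 2 ≤ d) (F : E d → ℝ) {x y : E d} (h : ‖x‖ = ‖y‖) :
    sphereMean F x = sphereMean F y := by
  obtain ⟨V, rfl⟩ := exists_rot_eq_of_norm_eq hd h
  simp_rw [sphereMean, ← rot_mul]
  exact (integral_mul_right_eq_self (fun U => F (rot U x)) V).symm

@[fun_prop]
theorem continuous_sphereMean (hF : Continuous F) : Continuous (sphereMean F) := by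
  have h := continuous_parametric_integral_of_continuous (μ := haarSO d)
    (f := fun x U => F (rot U x)) (by fun_prop) isCompact_univ
  rwa [Measure.restrict_univ] at h

theorem abs_sphereMean_le {M : ℝ} (hM : ∀ x, |F x| ≤ M) (x : E d) : |sphereMean F x| ≤ M := by
  simpa [sphereMean] using norm_integral_le_of_norm_le_const (μ := haarSO d)
    (f := fun U => F (rot U x)) (ae_of_all _ fun U => hM _)

theorem setIntegral_ball_sphereMean (hF : Continuous F) (s : ℝ) :
    ∫ x in Metric.ball 0 s, sphereMean F x = ∫ x in Metric.ball 0 s, F x := by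
  have hrot (U : SO d) :
      ∫ x in Metric.ball (0 : E d) s, F (rot U x) = ∫ x in Metric.ball (0 : E d) s, F x := by
    have hpre : rot U ⁻¹' Metric.ball 0 s = Metric.ball 0 s := by
      ext x
      simp [norm_rot]
    simpa only [hpre] using (measurePreserving_rot U).setIntegral_preimage_emb
      (measurableEmbedding_rot U) F (Metric.ball 0 s)
  have hint : Integrable (Function.uncurry fun (x : E d) (U : SO d) => F (rot U x))
      ((volume.restrict (Metric.ball 0 s)).prod (haarSO d)) := by
    have hc : Continuous (Function.uncurry fun (x : E d) (U : SO d) => F (rot U x)) := by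
      unfold Function.uncurry
      fun_prop
    have := (hc.continuousOn.integrableOn_compact (μ := volume.prod (haarSO d))
      ((isCompact_closedBall 0 s).prod isCompact_univ)).mono_set
        (prod_mono_left Metric.ball_subset_closedBall)
    rwa [IntegrableOn, ← Measure.prod_restrict, Measure.restrict_univ] at this
  calc ∫ x in Metric.ball 0 s, sphereMean F x
      = ∫ U, (∫ x in Metric.ball (0 : E d) s, F (rot U x)) ∂haarSO d := integral_integral_swap hint
    _ = ∫ x in Metric.ball 0 s, F x := by simp only [hrot, integral_const, probReal_univ, one_smul]

theorem setIntegral_ball_eq_integral_sphereMean (hd : 2 ≤ d) (hF : Continuous F) {y : E d}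
    (hy : y ≠ 0) {s : ℝ} (hs : 0 ≤ s) :
    ∫ x in Metric.ball 0 (‖y‖ * s), F x = d * volume.real (Metric.ball (0 : E d) 1) *
      (‖y‖ ^ d * ∫ u in (0 : ℝ)..s, u ^ (d - 1) * sphereMean F (u • y)) := by
  have : Nontrivial (E d) := ⟨y, 0, hy⟩
  have hyn : ‖y‖ ≠ 0 := norm_ne_zero_iff.2 hy
  have hmean (x : E d) : sphereMean F x = sphereMean F ((‖x‖ / ‖y‖) • y) :=
    sphereMean_congr_norm hd F (by rw [norm_smul, norm_div, norm_norm, norm_norm,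
      div_mul_cancel₀ _ hyn])
  have hpow : ‖y‖ ^ d = ‖y‖ ^ (d - 1) * ‖y‖ := by rw [← pow_succ, Nat.sub_add_cancel (by omega)]
  have hscale : ∫ u in (0 : ℝ)..‖y‖ * s, u ^ (d - 1) * sphereMean F ((u / ‖y‖) • y) =
      ‖y‖ ^ d * ∫ u in (0 : ℝ)..s, u ^ (d - 1) * sphereMean F (u • y) := by
    have := intervalIntegral.mul_integral_comp_mul_left (a := 0) (b := s) ‖y‖
      (f := fun u => u ^ (d - 1) * sphereMean F ((u / ‖y‖) • y))
    rw [mul_zero] at this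
    rw [← this, hpow, mul_comm (‖y‖ ^ _), mul_assoc, ← intervalIntegral.integral_const_mul]
    simp only [mul_pow, mul_div_cancel_left₀ _ hyn, mul_assoc, intervalIntegral.integral_const_mul]
  rw [← setIntegral_ball_sphereMean hF, integral_congr_ae (ae_of_all _ hmean),
    setIntegral_ball_fun_norm volume (fun u => sphereMean F ((u / ‖y‖) • y))
      (mul_nonneg (norm_nonneg y) hs), finrank_euclideanSpace_fin, hscale]

theorem abs_integral_sphereMean_sub_comp_add_le (hd : 2 ≤ d) (hF : Continuous F)
    (hb : ∀ x, |F x| ≤ 1) (h : E d) {y : E d} (hy : y ≠ 0) {s : ℝ} (hs : 0 < s)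
    (hhs : ‖h‖ / ‖y‖ ≤ s) :
    |∫ u in (0 : ℝ)..s, u ^ (d - 1) * sphereMean (fun x => F x - F (x + h)) (u • y)| ≤
      2 ^ d * (‖h‖ / ‖y‖) * s ^ (d - 1) := by
  have hyn : 0 < ‖y‖ := norm_pos_iff.2 hy
  have hys : 0 < ‖y‖ * s := mul_pos hyn hs
  have hω : 0 < volume.real (Metric.ball (0 : E d) 1) :=
    ENNReal.toReal_pos (Metric.measure_ball_pos _ _ one_pos).ne' measure_ball_lt_top.ne
  have hthin : (‖y‖ * s + ‖h‖) ^ d - (‖y‖ * s) ^ d ≤ ‖h‖ * d * (2 * (‖y‖ * s)) ^ (d - 1) := by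
    have hpow := (le_abs_self _).trans (abs_pow_sub_pow_le (‖y‖ * s + ‖h‖) (‖y‖ * s) d)
    have hh : ‖h‖ ≤ ‖y‖ * s := by rwa [div_le_iff₀' hyn] at hhs
    rw [add_sub_cancel_left, abs_norm, abs_of_pos hys, abs_of_pos (by positivity),
      max_eq_left (by linarith [norm_nonneg h])] at hpow
    exact hpow.trans (by gcongr; linarith)
  have hball := abs_setIntegral_ball_sub_comp_add_le volume hF.locallyIntegrable hb h hys
  rw [setIntegral_ball_eq_integral_sphereMean hd (by fun_prop) hy hs.le, ← mul_assoc,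
    abs_mul, abs_of_nonneg (by positivity), finrank_euclideanSpace_fin] at hball
  refine le_of_mul_le_mul_left ?_
    (by positivity : 0 < d * volume.real (Metric.ball (0 : E d) 1) * ‖y‖ ^ d)
  refine (hball.trans <| mul_le_mul_of_nonneg_left
    (mul_le_mul_of_nonneg_right hthin hω.le) (by norm_num)).trans_eq ?_
  obtain ⟨n, rfl⟩ : ∃ n, d = n + 1 := ⟨d - 1, by omega⟩
  field_simp [hyn.ne']
  simp only [Nat.add_sub_cancel]
  ring

end SphereMeans

section Chords

theorem abs_integral_mul_le_of_hasDerivAt {m m' G g : ℝ → ℝ} {a b A B : ℝ} (hab : a ≤ b)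
    (hm : ∀ x ∈ uIcc a b, HasDerivAt m (m' x) x) (hG : ∀ x ∈ uIcc a b, HasDerivAt G (g x) x)
    (hm' : IntervalIntegrable m' volume a b) (hg : IntervalIntegrable g volume a b)
    (hA : ∀ x ∈ uIcc a b, |m x * G x| ≤ A) (hB : ∀ x ∈ uIcc a b, |m' x * G x| ≤ B) :
    |∫ x in a..b, m x * g x| ≤ 2 * A + B * (b - a) := by
  have hint := intervalIntegral.norm_integral_le_of_norm_le_const
    (f := fun x => m' x * G x) fun x hx => hB x (uIoc_subset_uIcc hx)
  rw [abs_of_nonneg (sub_nonneg.2 hab), Real.norm_eq_abs] at hint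
  rw [intervalIntegral.integral_mul_deriv_eq_deriv_mul hm hG hm' hg]
  linarith [abs_sub (m b * G b - m a * G a) (∫ x in a..b, m' x * G x),
    abs_sub (m b * G b) (m a * G a), hA a left_mem_uIcc, hA b right_mem_uIcc]

/-- The weight `m` for which `∫ N(sin(τ/2)) dτ = ∫ m d(W(sin(τ/2)))`, where `W' = N(u) uⁿ`. -/
def chordWeight (n : ℕ) (τ : ℝ) : ℝ := (Real.sin (τ / 2) ^ n * (Real.cos (τ / 2) / 2))⁻¹

theorem hasDerivAt_sin_half (τ : ℝ) :
    HasDerivAt (fun τ => Real.sin (τ / 2)) (Real.cos (τ / 2) / 2) τ := by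
  simpa only [mul_one_div, id] using ((hasDerivAt_id τ).div_const 2).sin

theorem hasDerivAt_cos_half (τ : ℝ) :
    HasDerivAt (fun τ => Real.cos (τ / 2)) (-Real.sin (τ / 2) / 2) τ := by
  simpa only [mul_one_div, id] using ((hasDerivAt_id τ).div_const 2).cos

theorem hasDerivAt_chordWeight (n : ℕ) {τ : ℝ} (hs : Real.sin (τ / 2) ≠ 0)
    (hc : Real.cos (τ / 2) ≠ 0) :
    HasDerivAt (chordWeight n) (chordWeight n τ *
      (Real.sin (τ / 2) / Real.cos (τ / 2) - n * (Real.cos (τ / 2) / Real.sin (τ / 2))) / 2) τ := by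
  have h := (((hasDerivAt_sin_half τ).pow n).mul ((hasDerivAt_cos_half τ).div_const 2)).inv
    (by simp [hs, hc])
  refine h.congr_deriv ?_
  rcases n with _ | n
  · simp [chordWeight]
    field_simp
  · simp [chordWeight]
    field_simp
    ring

theorem le_sin_half {τ : ℝ} (h0 : 0 ≤ τ) (h1 : τ ≤ 1) : τ / 4 ≤ Real.sin (τ / 2) := by
  have h := Real.mul_le_sin (x := τ / 2) (by linarith) (by linarith [Real.pi_gt_three])
  refine le_trans ?_ h
  rw [div_mul_div_comm, mul_comm Real.pi, ← div_mul_div_comm, div_self two_ne_zero, one_mul]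
  exact div_le_div_of_nonneg_left h0 Real.pi_pos Real.pi_le_four

theorem half_le_cos_half {τ : ℝ} (h0 : 0 ≤ τ) (h1 : τ ≤ 1) : 1 / 2 ≤ Real.cos (τ / 2) := by
  nlinarith [Real.one_sub_sq_div_two_le_cos (x := τ / 2)]

theorem abs_chordWeight_mul_le {n : ℕ} {A τ w : ℝ} (hA : 0 ≤ A) (h0 : 0 < τ) (h1 : τ ≤ 1)
    (hw : |w| ≤ A * Real.sin (τ / 2) ^ n) : |chordWeight n τ * w| ≤ 4 * A := by
  have hs : 0 < Real.sin (τ / 2) := (by positivity : 0 < τ / 4).trans_le (le_sin_half h0.le h1)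
  have hc := half_le_cos_half h0.le h1
  have : 0 < Real.cos (τ / 2) := by linarith
  rw [chordWeight, abs_mul, abs_of_pos (by positivity), inv_mul_le_iff₀ (by positivity)]
  nlinarith [mul_nonneg hA (pow_pos hs n).le]

theorem abs_deriv_chordWeight_mul_le {n : ℕ} {A τ w : ℝ} (hA : 0 ≤ A) (h0 : 0 < τ) (h1 : τ ≤ 1)
    (hw : |w| ≤ A * Real.sin (τ / 2) ^ n) :
    |chordWeight n τ *
      (Real.sin (τ / 2) / Real.cos (τ / 2) - n * (Real.cos (τ / 2) / Real.sin (τ / 2))) / 2 * w| ≤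
      4 * A * (1 + 2 * n / τ) := by
  have hs := le_sin_half h0.le h1
  have hs0 : 0 < Real.sin (τ / 2) := (by positivity : 0 < τ / 4).trans_le hs
  have hc := half_le_cos_half h0.le h1
  have htan : |Real.sin (τ / 2) / Real.cos (τ / 2)| ≤ 2 := by
    rw [abs_div, abs_of_pos (by linarith : 0 < Real.cos (τ / 2)), div_le_iff₀ (by linarith)]
    linarith [Real.abs_sin_le_one (τ / 2)]
  have hcot : |n * (Real.cos (τ / 2) / Real.sin (τ / 2))| ≤ 4 * n / τ := by
    rw [abs_mul, Nat.abs_cast, abs_div, abs_of_pos hs0, mul_comm (4 : ℝ), mul_div_assoc]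
    refine mul_le_mul_of_nonneg_left ?_ n.cast_nonneg
    rw [div_le_div_iff₀ hs0 h0]
    nlinarith [Real.abs_cos_le_one (τ / 2)]
  calc _ = |chordWeight n τ * w| *
        (|Real.sin (τ / 2) / Real.cos (τ / 2) - n * (Real.cos (τ / 2) / Real.sin (τ / 2))| /
          2) := by
        simp only [abs_mul, abs_div, abs_two]
        ring
    _ ≤ 4 * A * ((2 + 4 * n / τ) / 2) := by
        gcongr
        · exact abs_chordWeight_mul_le hA h0 h1 hw
        · exact (abs_sub _ _).trans (add_le_add htan hcot)
    _ = 4 * A * (1 + 2 * n / τ) := by ring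

theorem abs_integral_comp_sin_half_le_of_pos {N : ℝ → ℝ} (hN : Continuous N) {n : ℕ} {A a T : ℝ}
    (hA : 0 ≤ A) (ha : 0 < a) (haT : a ≤ T) (hT : T ≤ 1)
    (hW : ∀ τ ∈ Icc a T,
      |∫ u in (0 : ℝ)..Real.sin (τ / 2), u ^ n * N u| ≤ A * Real.sin (τ / 2) ^ n) :
    |∫ τ in a..T, N (Real.sin (τ / 2))| ≤ 2 * (4 * A) + 4 * A * (1 + 2 * n / a) * (T - a) := by
  rw [← uIcc_of_le haT] at hW
  have hmem (τ : ℝ) (hτ : τ ∈ uIcc a T) : a ≤ τ ∧ 0 < τ ∧ τ ≤ 1 := by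
    rw [uIcc_of_le haT] at hτ
    exact ⟨hτ.1, ha.trans_le hτ.1, hτ.2.trans hT⟩
  have hsin (τ : ℝ) (hτ : τ ∈ uIcc a T) : Real.sin (τ / 2) ≠ 0 := by
    obtain ⟨-, h0, h1⟩ := hmem τ hτ
    exact ((by positivity : 0 < τ / 4).trans_le (le_sin_half h0.le h1)).ne'
  have hcos (τ : ℝ) (hτ : τ ∈ uIcc a T) : Real.cos (τ / 2) ≠ 0 := by
    obtain ⟨-, h0, h1⟩ := hmem τ hτ
    exact (one_half_pos.trans_le (half_le_cos_half h0.le h1)).ne'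
  let W : ℝ → ℝ := fun x => ∫ u in (0 : ℝ)..x, u ^ n * N u
  have hderivW (τ : ℝ) : HasDerivAt (fun τ => W (Real.sin (τ / 2)))
      (Real.sin (τ / 2) ^ n * N (Real.sin (τ / 2)) * (Real.cos (τ / 2) / 2)) τ :=
    ((by fun_prop : Continuous fun u => u ^ n * N u).integral_hasStrictDerivAt 0 _).hasDerivAt.comp
      τ (hasDerivAt_sin_half τ)
  have hweight (τ : ℝ) (hτ : τ ∈ uIcc a T) : chordWeight n τ *
      (Real.sin (τ / 2) ^ n * N (Real.sin (τ / 2)) * (Real.cos (τ / 2) / 2)) =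
      N (Real.sin (τ / 2)) := by
    have := hsin τ hτ
    have := hcos τ hτ
    rw [chordWeight]
    field_simp
  rw [← intervalIntegral.integral_congr hweight]
  refine abs_integral_mul_le_of_hasDerivAt haT
    (fun τ hτ => hasDerivAt_chordWeight n (hsin τ hτ) (hcos τ hτ)) (fun τ _ => hderivW τ)
    (ContinuousOn.intervalIntegrable ?_) ((by fun_prop : Continuous _).intervalIntegrable _ _)
    (fun τ hτ => abs_chordWeight_mul_le hA (hmem τ hτ).2.1 (hmem τ hτ).2.2 (hW τ hτ))
    fun τ hτ => (abs_deriv_chordWeight_mul_le hA (hmem τ hτ).2.1 (hmem τ hτ).2.2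
      (hW τ hτ)).trans ?_
  · have hw : ContinuousOn (chordWeight n) (uIcc a T) := fun τ hτ =>
      (hasDerivAt_chordWeight n (hsin τ hτ) (hcos τ hτ)).continuousAt.continuousWithinAt
    fun_prop (disch := assumption)
  · gcongr
    exact (hmem τ hτ).1

-- On `[0, √t]` the integral is bounded trivially; for `τ ≥ √t` we have `sin (τ / 2) ≥ t`.
theorem abs_integral_comp_sin_half_le {N : ℝ → ℝ} (hN : Continuous N) (hN2 : ∀ u, |N u| ≤ 2)
    {n : ℕ} {K t : ℝ} (hK : 0 ≤ K) (ht : 0 < t)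
    (hW : ∀ s, 0 < s → t ≤ s → |∫ u in (0 : ℝ)..s, u ^ n * N u| ≤ K * t * s ^ n)
    {T : ℝ} (hT0 : 0 ≤ T) (hT1 : T ≤ 1) :
    |∫ τ in (0 : ℝ)..T, N (Real.sin (τ / 2))| ≤ (8 + (8 * n + 6) * K) * √t := by
  set q := √t
  have hq : 0 < q := Real.sqrt_pos.2 ht
  have hqq : q * q = t := Real.mul_self_sqrt ht.le
  have hKq : 0 ≤ (8 * n + 6) * K * q := by positivity
  have htriv (T' : ℝ) (hT' : 0 ≤ T') : |∫ τ in (0 : ℝ)..T', N (Real.sin (τ / 2))| ≤ 2 * T' := by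
    simpa [abs_of_nonneg hT'] using intervalIntegral.norm_integral_le_of_norm_le_const
      (a := 0) (b := T') (f := fun τ => N (Real.sin (τ / 2))) fun x _ => hN2 _
  rcases lt_or_ge (1 / 4) q with hq4 | hq4
  · nlinarith [htriv T hT0]
  rcases le_or_gt T q with hTq | hTq
  · nlinarith [htriv T hT0]
  have hparts := abs_integral_comp_sin_half_le_of_pos hN (mul_nonneg hK ht.le) hq hTq.le hT1
    fun τ hτ => by
      have hsin := le_sin_half (hq.le.trans hτ.1) (hτ.2.trans hT1)
      exact hW _ (by linarith [hτ.1]) (by nlinarith [hτ.1])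
  have hsplit := intervalIntegral.integral_add_adjacent_intervals
    ((by fun_prop : Continuous fun τ => N (Real.sin (τ / 2))).intervalIntegrable (μ := volume) 0 q)
    ((by fun_prop : Continuous fun τ => N (Real.sin (τ / 2))).intervalIntegrable q T)
  have hKt : 4 * (K * t) * (1 + 2 * n / q) * (T - q) ≤ 4 * K * (q + 2 * n) * q := by
    calc 4 * (K * t) * (1 + 2 * n / q) * (T - q)
        ≤ 4 * (K * t) * (1 + 2 * n / q) * 1 := by gcongr; linarith
      _ = 4 * K * (q + 2 * n) * q := by rw [← hqq]; field_simp
  rw [← hsplit]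
  refine (abs_add_le _ _).trans ?_
  nlinarith [htriv q hq.le, mul_nonneg hK hq.le]

/-- The uniform probability measure on the angles in `(0, 1]`. -/
def angleMeasure : Measure ℝ := volume.restrict (Ioc 0 1)

instance : IsProbabilityMeasure angleMeasure := ⟨by simp [angleMeasure]⟩

/-- The constant in the regularity estimate for averages over chords. -/
def chordConst (d : ℕ) : ℝ := 16 * (1 + d * 2 ^ d)

theorem chordConst_pos (d : ℕ) : 0 < chordConst d := by unfold chordConst; positivity

theorem integral_angleMeasure_comp_sub {g : ℝ → ℝ} (hg : Continuous g) (heven : ∀ u, g (-u) = g u)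
    (θ' : ℝ) :
    ∫ θ, g (θ - θ') ∂angleMeasure =
      (∫ τ in (0 : ℝ)..θ', g τ) + ∫ τ in (0 : ℝ)..(1 - θ'), g τ := by
  rw [angleMeasure, ← intervalIntegral.integral_of_le zero_le_one,
    intervalIntegral.integral_comp_sub_right g θ', zero_sub,
    ← intervalIntegral.integral_add_adjacent_intervals (hg.intervalIntegrable (-θ') 0)
      (hg.intervalIntegrable 0 (1 - θ'))]
  simpa only [heven, neg_zero] using
    congrArg (· + _) (intervalIntegral.integral_comp_neg (a := 0) (b := θ') g).symm

-- `w` runs through the chords of a circle of diameter `‖y‖` that start at the point of angle `θ'`.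
theorem abs_integral_chord_sub_comp_add_le {d : ℕ} (hd : 2 ≤ d) {F : E d → ℝ} (hF : Continuous F)
    (hb : ∀ x, |F x| ≤ 1) (h : E d) {y : E d} (hy : y ≠ 0) {θ' : ℝ} (hθ' : θ' ∈ Ioc (0 : ℝ) 1)
    {w : ℝ → E d} (hw : ∀ θ, ‖w θ‖ = |Real.sin ((θ - θ') / 2)| * ‖y‖) :
    |∫ θ, sphereMean (fun x => F x - F (x + h)) (w θ) ∂angleMeasure| ≤
      chordConst d * √(‖h‖ / ‖y‖) := by
  rcases eq_or_ne h 0 with rfl | hh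
  · simp [sphereMean]
  let D : E d → ℝ := fun x => F x - F (x + h)
  let N : ℝ → ℝ := fun u => sphereMean D (u • y)
  have hNc : Continuous N := (continuous_sphereMean (by fun_prop)).comp (by fun_prop)
  have hN2 (u : ℝ) : |N u| ≤ 2 := abs_sphereMean_le (fun x => (abs_sub _ _).trans
    (by linarith [hb x, hb (x + h)])) _
  have harc (T : ℝ) (h0 : 0 ≤ T) (h1 : T ≤ 1) : |∫ τ in (0 : ℝ)..T, N (Real.sin (τ / 2))| ≤
      (8 + (8 * (d - 1 : ℕ) + 6) * 2 ^ d) * √(‖h‖ / ‖y‖) :=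
    abs_integral_comp_sin_half_le hNc hN2 (by positivity)
      (div_pos (norm_pos_iff.2 hh) (norm_pos_iff.2 hy))
      (fun s hs hts => abs_integral_sphereMean_sub_comp_add_le hd hF hb h hy hs hts) h0 h1
  have hwN (θ : ℝ) : sphereMean D (w θ) = N (Real.sin ((θ - θ') / 2)) :=
    sphereMean_congr_norm hd D (by rw [hw, norm_smul, Real.norm_eq_abs])
  have heven (τ : ℝ) : N (Real.sin (-τ / 2)) = N (Real.sin (τ / 2)) :=
    sphereMean_congr_norm hd D (by rw [neg_div, Real.sin_neg, neg_smul, norm_neg])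
  have hconst : 2 * (8 + (8 * ((d - 1 : ℕ) : ℝ) + 6) * 2 ^ d) ≤ chordConst d := by
    rw [chordConst, Nat.cast_sub (by omega), Nat.cast_one]
    nlinarith [(by positivity : (0 : ℝ) < 2 ^ d)]
  change |∫ θ, sphereMean D (w θ) ∂angleMeasure| ≤ _
  simp_rw [hwN]
  rw [integral_angleMeasure_comp_sub (g := fun τ => N (Real.sin (τ / 2))) (by fun_prop) heven]
  calc _ ≤ _ := abs_add_le _ _
    _ ≤ 2 * (8 + (8 * (d - 1 : ℕ) + 6) * 2 ^ d) * √(‖h‖ / ‖y‖) := by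
        linarith [harc θ' hθ'.1.le hθ'.2, harc (1 - θ') (by linarith [hθ'.2]) (by linarith [hθ'.1])]
    _ ≤ chordConst d * √(‖h‖ / ‖y‖) := by gcongr

end Chords

/-! ### Autocorrelations -/

/-- Measurable functions on `ℝ^d` that are bounded by `1` both pointwise and in `L¹`. This class
contains the indicator functions of subsets of the unit cube and their balanced versions. -/
structure IsUnitBounded {d : ℕ} (f : E d → ℝ) : Prop where
  measurable : Measurable f
  abs_le : ∀ x, |f x| ≤ 1
  integrable : Integrable f
  integral_abs_le : ∫ x, |f x| ≤ 1

/-- The autocorrelation of a function. -/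
def corr {d : ℕ} (f : E d → ℝ) (y : E d) : ℝ := ∫ x, f x * f (x - y)

section Correlations

variable {d : ℕ} {f : E d → ℝ}

theorem IsUnitBounded.mul (hf : IsUnitBounded f) {g : E d → ℝ} (hg : Measurable g)
    (hg1 : ∀ x, |g x| ≤ 1) : IsUnitBounded fun x => f x * g x := by
  have hle (x : E d) : |f x * g x| ≤ |f x| := by
    rw [abs_mul]
    exact mul_le_of_le_one_right (abs_nonneg _) (hg1 x)
  have hint : Integrable fun x => f x * g x :=
    hf.integrable.mono (hf.measurable.mul hg).aestronglyMeasurable (ae_of_all _ hle)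
  exact ⟨hf.measurable.mul hg, fun x => (hle x).trans (hf.abs_le x), hint,
    (integral_mono hint.abs hf.integrable.abs hle).trans hf.integral_abs_le⟩

theorem IsUnitBounded.comp_sub_right (hf : IsUnitBounded f) (a : E d) :
    IsUnitBounded fun x => f (x - a) :=
  ⟨hf.measurable.comp (measurable_sub_const a), fun _ => hf.abs_le _,
    hf.integrable.comp_sub_right a,
    (integral_sub_right_eq_self (fun x => |f x|) a).trans_le hf.integral_abs_le⟩

theorem IsUnitBounded.abs_integral_le (hf : IsUnitBounded f) : |∫ x, f x| ≤ 1 :=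
  abs_integral_le_integral_abs.trans hf.integral_abs_le

theorem IsUnitBounded.memLp_two (hf : IsUnitBounded f) : MemLp f 2 :=
  (memLp_two_iff_integrable_sq hf.measurable.aestronglyMeasurable).2 <| by
    simpa only [sq] using (hf.mul hf.measurable hf.abs_le).integrable

theorem IsUnitBounded.integral_sq_le (hf : IsUnitBounded f) : ∫ x, f x ^ 2 ≤ 1 := by
  simpa only [sq] using (le_abs_self _).trans (hf.mul hf.measurable hf.abs_le).abs_integral_le

theorem IsUnitBounded.integrable_uncurry {Ω : Type*} [MeasurableSpace Ω] {P : Measure Ω}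
    [IsProbabilityMeasure P] {Φ : E d → Ω → ℝ} (hΦ : Measurable (Function.uncurry Φ))
    (hΦ1 : ∀ ω, IsUnitBounded (Φ · ω)) : Integrable (Function.uncurry Φ) (volume.prod P) := by
  refine (integrable_prod_iff' hΦ.aestronglyMeasurable).2
    ⟨ae_of_all _ fun ω => (hΦ1 ω).integrable, ?_⟩
  refine Integrable.of_bound (C := 1)
    (hΦ.comp measurable_swap).norm.stronglyMeasurable.integral_prod_right'.aestronglyMeasurable
    (ae_of_all _ fun ω => ?_)
  rw [Real.norm_of_nonneg (integral_nonneg fun _ => norm_nonneg _)]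
  exact (hΦ1 ω).integral_abs_le

theorem IsUnitBounded.integral {Ω : Type*} [MeasurableSpace Ω] {P : Measure Ω}
    [IsProbabilityMeasure P] {Φ : E d → Ω → ℝ} (hΦ : Measurable (Function.uncurry Φ))
    (hΦ1 : ∀ ω, IsUnitBounded (Φ · ω)) : IsUnitBounded fun x => ∫ ω, Φ x ω ∂P := by
  have hint := integrable_uncurry (P := P) hΦ hΦ1
  refine ⟨hΦ.stronglyMeasurable.integral_prod_right'.measurable, fun x => ?_,
    hint.integral_prod_left, ?_⟩
  · simpa using norm_integral_le_of_norm_le_const (μ := P) (f := Φ x) (C := 1)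
      (ae_of_all _ fun ω => (hΦ1 ω).abs_le x)
  · calc ∫ x, |∫ ω, Φ x ω ∂P| ≤ ∫ x, ∫ ω, |Φ x ω| ∂P :=
          integral_mono hint.integral_prod_left.abs hint.abs.integral_prod_left
            fun _ => abs_integral_le_integral_abs
      _ = ∫ ω, (∫ x, |Φ x ω|) ∂P := integral_integral_swap hint.abs
      _ ≤ ∫ _ω, 1 ∂P := integral_mono hint.abs.integral_prod_right (integrable_const 1)
            fun ω => (hΦ1 ω).integral_abs_le
      _ = 1 := by simp

theorem IsUnitBounded.abs_corr_le (hf : IsUnitBounded f) (y : E d) : |corr f y| ≤ 1 :=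
  (hf.mul (hf.comp_sub_right y).measurable fun _ => hf.abs_le _).abs_integral_le

theorem IsUnitBounded.continuous_corr (hf : IsUnitBounded f) : Continuous (corr f) := by
  let τ : C(E d, C(E d, E d)) :=
    ContinuousMap.curry ⟨fun p : E d × E d => p.2 - p.1, by fun_prop⟩
  have hτ (y : E d) : MeasurePreserving (τ y) := measurePreserving_sub_right volume y
  let φ := hf.memLp_two.toLp
  have htranslate : Continuous fun y => Lp.compMeasurePreserving (τ y) (hτ y) φ :=
    continuous_const.compMeasurePreservingLp τ.continuous hτ (by simp)
  have hinner : corr f = fun y => inner ℝ φ (Lp.compMeasurePreserving (τ y) (hτ y) φ) := by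
    ext y
    rw [L2.inner_def, corr]
    refine integral_congr_ae ?_
    filter_upwards [hf.memLp_two.coeFn_toLp, Lp.coeFn_compMeasurePreserving φ (hτ y),
      (hτ y).quasiMeasurePreserving.ae hf.memLp_two.coeFn_toLp] with x hx hτx hφτx
    rw [hx, hτx, Function.comp_apply, hφτx]
    simp [τ, mul_comm]
  rw [hinner]
  fun_prop

theorem IsUnitBounded.corr_le_integral_sq (hf : IsUnitBounded f) (y : E d) :
    corr f y ≤ ∫ x, f x ^ 2 := by
  have hint := hf.memLp_two.integrable_sq
  have hinty := (hf.comp_sub_right y).memLp_two.integrable_sq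
  calc corr f y ≤ ∫ x, (1 / 2) * (f x ^ 2 + f (x - y) ^ 2) :=
        integral_mono (hf.mul (hf.comp_sub_right y).measurable fun _ => hf.abs_le _).integrable
          ((hint.add hinty).const_mul _) fun x => by
            linarith [two_mul_le_add_sq (f x) (f (x - y))]
    _ = ∫ x, f x ^ 2 := by
        rw [integral_const_mul, integral_add hint hinty,
          integral_sub_right_eq_self (fun x => f x ^ 2) y]
        ring

theorem integral_sub_mul_sub (f : E d → ℝ) (a b : E d) :
    ∫ x, f (x - a) * f (x - b) = corr f (b - a) := by
  rw [corr, ← integral_sub_right_eq_self (fun x => f x * f (x - (b - a))) a]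
  simp only [sub_sub, add_sub_cancel]

theorem IsUnitBounded.corr_integral_comp_sub (hf : IsUnitBounded f) {Ω : Type*}
    [MeasurableSpace Ω] {P : Measure Ω} [IsProbabilityMeasure P] {z : Ω → E d}
    (hz : Measurable z) (y : E d) :
    corr (fun x => ∫ ω, f (x - z ω) ∂P) y =
      ∫ q : Ω × Ω, corr f (y + (z q.2 - z q.1)) ∂(P.prod P) := by
  have hmeas : Measurable (Function.uncurry fun (x : E d) (q : Ω × Ω) =>
      f (x - z q.1) * f (x - (y + z q.2))) :=
    (hf.measurable.comp (by fun_prop)).mul (hf.measurable.comp (by fun_prop))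
  have hprod (x : E d) : (∫ ω, f (x - z ω) ∂P) * ∫ ω, f (x - y - z ω) ∂P =
      ∫ q : Ω × Ω, f (x - z q.1) * f (x - (y + z q.2)) ∂(P.prod P) := by
    simp_rw [← integral_prod_mul, sub_sub]
  simp_rw [corr, hprod]
  rw [integral_integral_swap (integrable_uncurry hmeas fun q => (hf.comp_sub_right _).mul
    (hf.comp_sub_right _).measurable fun _ => hf.abs_le _)]
  simp_rw [integral_sub_mul_sub, add_sub_assoc, corr]

end Correlations

theorem sq_integral_mul_le {α : Type*} [MeasurableSpace α] {μ : Measure α} {φ g : α → ℝ}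
    (hφ : MemLp φ 2 μ) (hg : MemLp g 2 μ) (hφ1 : ∫ x, φ x ^ 2 ∂μ ≤ 1) :
    (∫ x, φ x * g x ∂μ) ^ 2 ≤ ∫ x, g x ^ 2 ∂μ := by
  set J := ∫ x, φ x * g x ∂μ with hJ
  have hquad : Integrable (fun x => J ^ 2 * φ x ^ 2) μ := hφ.integrable_sq.const_mul _
  have hmul : Integrable (fun x => 2 * J * (φ x * g x)) μ := (hφ.integrable_mul hg).const_mul _
  have hsub : Integrable (fun x => J ^ 2 * φ x ^ 2 - 2 * J * (φ x * g x)) μ := hquad.sub hmul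
  have hexp : ∫ x, (J * φ x - g x) ^ 2 ∂μ =
      J ^ 2 * (∫ x, φ x ^ 2 ∂μ) - 2 * J * J + ∫ x, g x ^ 2 ∂μ := by
    calc ∫ x, (J * φ x - g x) ^ 2 ∂μ
        = ∫ x, (J ^ 2 * φ x ^ 2 - 2 * J * (φ x * g x) + g x ^ 2) ∂μ := by
          congr with x; ring
      _ = _ := by
          rw [integral_add hsub hg.integrable_sq,
            integral_sub hquad hmul, integral_const_mul, integral_const_mul, ← hJ]
  have hnonneg : 0 ≤ ∫ x, (J * φ x - g x) ^ 2 ∂μ := integral_nonneg fun x => sq_nonneg _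
  nlinarith [mul_le_mul_of_nonneg_left hφ1 (sq_nonneg J)]

/-! ### Averages over the rotated chords of a curve -/

/-- The average of `F` over the chords of the curve `w`, each of them rotated by a uniformly
distributed rotation. -/
def chordMean {d : ℕ} (w : ℝ → E d) (F : E d → ℝ) : ℝ :=
  ∫ r : (ℝ × ℝ) × SO d, F (rot r.2 (w r.1.2 - w r.1.1))
    ∂((angleMeasure.prod angleMeasure).prod (haarSO d))

section ChordMean

variable {d : ℕ} {w : ℝ → E d} {f : E d → ℝ}

theorem chordMean_le_add (hd : 2 ≤ d) {F : E d → ℝ} (hF : Continuous F) (hF1 : ∀ x, |F x| ≤ 1)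
    (hw : Continuous w) {b : ℝ} (hb : 0 < b)
    (hwb : ∀ θ θ', ‖w θ - w θ'‖ = |Real.sin ((θ - θ') / 2)| * b) (h : E d) :
    chordMean w F ≤ chordMean w (fun x => F (x + h)) + chordConst d * √(‖h‖ / b) := by
  have : Nontrivial (E d) := Module.nontrivial_of_finrank_pos (R := ℝ) (by simp; omega)
  obtain ⟨y, rfl⟩ := exists_norm_eq (E d) hb.le
  have hint {G : E d → ℝ} (hG : Continuous G) {M : ℝ} (hM : ∀ x, |G x| ≤ M) :
      Integrable (fun r : (ℝ × ℝ) × SO d => G (rot r.2 (w r.1.2 - w r.1.1)))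
        ((angleMeasure.prod angleMeasure).prod (haarSO d)) :=
    .of_bound (Continuous.aestronglyMeasurable (by fun_prop)) M (ae_of_all _ fun _ => hM _)
  have hFh : Continuous fun x => F (x + h) := by fun_prop
  have hdint := hint (G := fun x => F x - F (x + h)) (by fun_prop) (M := 1 + 1)
    fun x => (abs_sub _ _).trans (add_le_add (hF1 _) (hF1 _))
  have hdiff : chordMean w F - chordMean w (fun x => F (x + h)) =
      ∫ θ', ∫ θ, sphereMean (fun x => F x - F (x + h)) (w θ - w θ') ∂angleMeasure
        ∂angleMeasure := by
    rw [chordMean, chordMean, ← integral_sub (hint hF hF1) (hint hFh fun _ => hF1 _),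
      integral_prod _ hdint, integral_prod _ hdint.integral_prod_left]
    rfl
  have hchord : ∀ᵐ θ' ∂angleMeasure,
      ‖∫ θ, sphereMean (fun x => F x - F (x + h)) (w θ - w θ') ∂angleMeasure‖ ≤
        chordConst d * √(‖h‖ / ‖y‖) := by
    filter_upwards [ae_restrict_mem measurableSet_Ioc] with θ' hθ'
    exact abs_integral_chord_sub_comp_add_le hd hF hF1 h (norm_pos_iff.1 hb) hθ' (hwb · θ')
  have hle := norm_integral_le_of_norm_le_const hchord
  rw [← hdiff, probReal_univ, mul_one] at hle
  linarith [(le_abs_self _).trans hle]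

theorem IsUnitBounded.chordMean_corr_le (hd : 2 ≤ d) (hf : IsUnitBounded f)
    {κ : Measure (E d)} [IsProbabilityMeasure κ] {ρ : ℝ} (hκ : ∀ᵐ z ∂κ, ‖z‖ ≤ ρ)
    (hw : Continuous w) {b : ℝ} (hb : 0 < b)
    (hwb : ∀ θ θ', ‖w θ - w θ'‖ = |Real.sin ((θ - θ') / 2)| * b) :
    chordMean w (corr f) ≤
      (∫ x, (∫ z, f (x - z) ∂κ) ^ 2) + chordConst d * √(2 * ρ / b) := by
  have hcont := hf.continuous_corr
  set C := chordConst d * √(2 * ρ / b) with hC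
  set m := (angleMeasure.prod angleMeasure).prod (haarSO d) with hm
  have hint : Integrable (fun s : (E d × E d) × ((ℝ × ℝ) × SO d) =>
      corr f (rot s.2.2 (w s.2.1.2 - w s.2.1.1) + (s.1.2 - s.1.1))) ((κ.prod κ).prod m) :=
    Integrable.of_bound (Continuous.aestronglyMeasurable (by fun_prop)) 1
      (ae_of_all _ fun _ => hf.abs_corr_le _)
  have hshift : ∀ᵐ q : E d × E d ∂(κ.prod κ),
      chordMean w (corr f) ≤ chordMean w (fun x => corr f (x + (q.2 - q.1))) + C := by
    filter_upwards [Measure.quasiMeasurePreserving_fst.ae hκ,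
      Measure.quasiMeasurePreserving_snd.ae hκ] with q hq₁ hq₂
    refine (chordMean_le_add hd hcont hf.abs_corr_le hw hb hwb (q.2 - q.1)).trans ?_
    have := (chordConst_pos d).le
    rw [hC]
    gcongr
    linarith [norm_sub_le q.2 q.1]
  have havg : IsUnitBounded fun x => ∫ z, f (x - z) ∂κ :=
    .integral (hf.measurable.comp measurable_sub) fun z => hf.comp_sub_right z
  calc chordMean w (corr f) = ∫ _q : E d × E d, chordMean w (corr f) ∂(κ.prod κ) := by simp
    _ ≤ ∫ q : E d × E d, (chordMean w (fun x => corr f (x + (q.2 - q.1))) + C) ∂(κ.prod κ) :=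
        integral_mono_ae (integrable_const _) (hint.integral_prod_left.add (integrable_const C))
          hshift
    _ = (∫ r, (∫ q : E d × E d, corr f (rot r.2 (w r.1.2 - w r.1.1) + (q.2 - q.1))
          ∂(κ.prod κ)) ∂m) + C := by
        simp only [chordMean, ← hm]
        rw [integral_add hint.integral_prod_left (integrable_const C),
          integral_integral_swap hint]
        simp
    _ ≤ (∫ _r, (∫ x, (∫ z, f (x - z) ∂κ) ^ 2) ∂m) + C := by
        refine add_le_add (integral_mono hint.integral_prod_right (integrable_const _)
          fun r => ?_) le_rfl
        exact (hf.corr_integral_comp_sub measurable_id _).symm.trans_le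
          (havg.corr_le_integral_sq _)
    _ = _ := by simp

theorem IsUnitBounded.sq_integral_integral_mul_comp_sub_le (hf : IsUnitBounded f)
    {φ : E d → ℝ} (hφ : IsUnitBounded φ) {Ω : Type*} [MeasurableSpace Ω] {P : Measure Ω}
    [IsProbabilityMeasure P] {z : Ω → E d} (hz : Measurable z) :
    (∫ ω, (∫ x, φ x * f (x - z ω)) ∂P) ^ 2 ≤
      ∫ q : Ω × Ω, corr f (z q.2 - z q.1) ∂(P.prod P) := by
  have hmeas : Measurable (Function.uncurry fun x ω => f (x - z ω)) :=
    hf.measurable.comp (by fun_prop)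
  have hmeas' : Measurable (Function.uncurry fun x ω => φ x * f (x - z ω)) :=
    (hφ.measurable.comp measurable_fst).mul hmeas
  have hswap : ∫ ω, (∫ x, φ x * f (x - z ω)) ∂P = ∫ x, φ x * ∫ ω, f (x - z ω) ∂P := by
    rw [← integral_integral_swap (integrable_uncurry hmeas' fun ω =>
      hφ.mul (hf.comp_sub_right (z ω)).measurable fun _ => hf.abs_le _)]
    simp only [integral_const_mul]
  have havg : IsUnitBounded fun x => ∫ ω, f (x - z ω) ∂P :=
    .integral hmeas fun ω => hf.comp_sub_right (z ω)
  calc _ ≤ ∫ x, (∫ ω, f (x - z ω) ∂P) ^ 2 :=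
        hswap ▸ sq_integral_mul_le hφ.memLp_two havg.memLp_two hφ.integral_sq_le
    _ = corr (fun x => ∫ ω, f (x - z ω) ∂P) 0 := by simp only [corr, sub_zero, sq]
    _ = _ := by simp only [hf.corr_integral_comp_sub hz, zero_add]

theorem IsUnitBounded.integral_haarSO_mul_comp_sub_eq (hf : IsUnitBounded f)
    {Φ : E d → SO d → ℝ} (hΦ : Measurable (Function.uncurry Φ))
    (hΦ1 : ∀ U, IsUnitBounded (Φ · U)) {V : SO d} (hΦV : ∀ x U, Φ x (U * V) = Φ x U) (y : E d) :
    ∫ x, ∫ U, Φ x U * f (x - rot U y) ∂haarSO d =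
      ∫ U, (∫ x, Φ x U * f (x - rot U (rot V y))) ∂haarSO d := by
  have hrot : Continuous fun p : E d × SO d => rot p.2 y := by fun_prop
  have hmeas : Measurable (Function.uncurry fun x U => Φ x U * f (x - rot U y)) :=
    hΦ.mul (hf.measurable.comp (measurable_fst.sub hrot.measurable))
  rw [integral_integral_swap (integrable_uncurry hmeas fun U =>
      (hΦ1 U).mul (hf.comp_sub_right _).measurable fun _ => hf.abs_le _),
    ← integral_mul_right_eq_self _ V]
  simp only [hΦV, rot_mul]

theorem IsUnitBounded.sq_integral_le_chordMean_corr (hf : IsUnitBounded f)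
    {Φ : E d → SO d → ℝ} (hΦ : Measurable (Function.uncurry Φ))
    (hΦ1 : ∀ U, IsUnitBounded (Φ · U)) {H : ℝ → SO d} (hΦH : ∀ x U θ, Φ x (U * H θ) = Φ x U)
    {y : E d} (hy : Continuous fun θ => rot (H θ) y) :
    (∫ x, ∫ U, Φ x U * f (x - rot U y) ∂haarSO d) ^ 2 ≤
      chordMean (fun θ => rot (H θ) y) (corr f) := by
  set w : ℝ → E d := fun θ => rot (H θ) y with hw
  let K : SO d → ℝ → ℝ := fun U θ => ∫ x, Φ x U * f (x - rot U (w θ))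
  have hrot : Continuous fun p : SO d × ℝ => rot p.1 (w p.2) := by fun_prop
  have hmeas : Measurable fun s : (SO d × ℝ) × E d =>
      Φ s.2 s.1.1 * f (s.2 - rot s.1.1 (w s.1.2)) :=
    (hΦ.comp (measurable_snd.prodMk (measurable_fst.comp measurable_fst))).mul
      (hf.measurable.comp (measurable_snd.sub (hrot.measurable.comp measurable_fst)))
  have hK1 (U : SO d) (θ : ℝ) : ‖K U θ‖ ≤ 1 :=
    ((hΦ1 U).mul (hf.comp_sub_right _).measurable fun _ => hf.abs_le _).abs_integral_le
  have hKint : Integrable (Function.uncurry K) ((haarSO d).prod angleMeasure) :=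
    .of_bound hmeas.stronglyMeasurable.integral_prod_right'.aestronglyMeasurable 1
      (ae_of_all _ fun p => hK1 p.1 p.2)
  have hmean : ∫ x, ∫ U, Φ x U * f (x - rot U y) ∂haarSO d =
      ∫ U, (∫ θ, K U θ ∂angleMeasure) ∂haarSO d := by
    rw [integral_integral_swap hKint]
    simp only [K, hw, ← hf.integral_haarSO_mul_comp_sub_eq hΦ hΦ1 (hΦH · · _), integral_const,
      probReal_univ, one_smul]
  have hKmean : MemLp (fun U => ∫ θ, K U θ ∂angleMeasure) 2 (haarSO d) := by
    refine .of_bound hKint.integral_prod_left.aestronglyMeasurable 1 (ae_of_all _ fun U => ?_)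
    simpa using norm_integral_le_of_norm_le_const (μ := angleMeasure) (ae_of_all _ (hK1 U))
  have hcorr : Integrable (fun r : (ℝ × ℝ) × SO d => corr f (rot r.2 (w r.1.2 - w r.1.1)))
      ((angleMeasure.prod angleMeasure).prod (haarSO d)) := by
    have := hf.continuous_corr
    exact .of_bound (Continuous.aestronglyMeasurable (by fun_prop)) 1
      (ae_of_all _ fun _ => hf.abs_corr_le _)
  have hcirc (U : SO d) : (∫ θ, K U θ ∂angleMeasure) ^ 2 ≤
      ∫ q : ℝ × ℝ, corr f (rot U (w q.2 - w q.1)) ∂(angleMeasure.prod angleMeasure) := by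
    have hz : Continuous fun θ => rot U (w θ) := by fun_prop
    simpa only [rot_sub] using hf.sq_integral_integral_mul_comp_sub_le (hΦ1 U) hz.measurable
  calc _ = (∫ U, 1 * (∫ θ, K U θ ∂angleMeasure) ∂haarSO d) ^ 2 := by simp only [hmean, one_mul]
    _ ≤ ∫ U, (∫ θ, K U θ ∂angleMeasure) ^ 2 ∂haarSO d :=
        sq_integral_mul_le (memLp_const 1) hKmean (by simp)
    _ ≤ ∫ U, (∫ q : ℝ × ℝ, corr f (rot U (w q.2 - w q.1))
          ∂(angleMeasure.prod angleMeasure)) ∂haarSO d :=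
        integral_mono hKmean.integrable_sq hcorr.integral_prod_right hcirc
    _ = chordMean w (corr f) := (integral_prod_symm _ hcorr).symm

end ChordMean

/-! ### The generalized von Neumann inequality -/

section VonNeumann

theorem norm_smul_add_smul_of_inner_eq_zero {V : Type*} [NormedAddCommGroup V]
    [InnerProductSpace ℝ V] {a b : V} (hab : ‖b‖ = ‖a‖) (hinner : inner ℝ a b = 0) {s t : ℝ}
    (hst : s ^ 2 + t ^ 2 = 1) : ‖s • a + t • b‖ = ‖a‖ := by
  have hpyth := norm_add_sq_eq_norm_sq_add_norm_sq_real
    (x := s • a) (y := t • b) (by rw [inner_smul_left, inner_smul_right, hinner]; simp)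
  rw [norm_smul, norm_smul, hab, Real.norm_eq_abs, Real.norm_eq_abs] at hpyth
  rw [← sq_eq_sq₀ (norm_nonneg _) (norm_nonneg _)]
  linear_combination hpyth + ‖a‖ ^ 2 * (sq_abs s + sq_abs t + hst)

theorem norm_cos_smul_add_sin_smul_sub {V : Type*} [NormedAddCommGroup V]
    [InnerProductSpace ℝ V] {a b : V} (hab : ‖b‖ = ‖a‖) (hinner : inner ℝ a b = 0) (θ θ' : ℝ) :
    ‖(Real.cos θ • a + Real.sin θ • b) - (Real.cos θ' • a + Real.sin θ' • b)‖ =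
      |Real.sin ((θ - θ') / 2)| * (2 * ‖a‖) := by
  have hdiff : (Real.cos θ • a + Real.sin θ • b) - (Real.cos θ' • a + Real.sin θ' • b) =
      (2 * Real.sin ((θ - θ') / 2)) •
        (-Real.sin ((θ + θ') / 2) • a + Real.cos ((θ + θ') / 2) • b) := by
    rw [add_sub_add_comm, ← sub_smul, ← sub_smul, Real.cos_sub_cos, Real.sin_sub_sin]
    module
  rw [hdiff, norm_smul, norm_smul_add_smul_of_inner_eq_zero hab hinner
    (by rw [neg_sq, Real.sin_sq_add_cos_sq]), Real.norm_eq_abs, abs_mul, abs_two]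
  ring

variable {d k : ℕ} {v : Fin k → E d}

-- Turn the component of `v j` orthogonal to the other vertices towards a direction orthogonal to
-- all the vertices.
theorem exists_rot_circle (hd : k + 1 ≤ d) (v : Fin k → E d) (j : Fin k) :
    ∃ H : ℝ → SO d, (∀ θ i, i ≠ j → rot (H θ) (v i) = v i) ∧
      (Continuous fun θ => rot (H θ) (v j)) ∧
      ∀ θ θ', ‖rot (H θ) (v j) - rot (H θ') (v j)‖ = |Real.sin ((θ - θ') / 2)| *
        (2 * Metric.infDist (v j) (Submodule.span ℝ (v '' {j}ᶜ) : Set (E d))) := by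
  set S := Submodule.span ℝ (v '' {j}ᶜ)
  set T := Submodule.span ℝ (range v)
  let p := S.starProjection (v j)
  let a := v j - p
  have hpS : p ∈ S := Submodule.starProjection_apply_mem S (v j)
  have haS : a ∈ Sᗮ := Submodule.sub_starProjection_mem_orthogonal (v j)
  have hST : S ≤ T := Submodule.span_mono (image_subset_range _ _)
  have hvT (i : Fin k) : v i ∈ T := Submodule.subset_span (mem_range_self i)
  have hdist : Metric.infDist (v j) (S : Set (E d)) = ‖a‖ := by
    rw [Metric.infDist_eq_iInf, Submodule.starProjection_minimal]
    simp only [dist_eq_norm]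
    rfl
  obtain ⟨e, heT, he⟩ := exists_norm_eq_one_mem_orthogonal T
    ((finrank_span_range_le v).trans_lt hd)
  let b := ‖a‖ • e
  have hbT : b ∈ Tᗮ := Tᗮ.smul_mem _ heT
  have hba : ‖b‖ = ‖a‖ := by simp [b, norm_smul, he]
  have hab : inner ℝ a b = 0 :=
    Submodule.inner_right_of_mem_orthogonal (T.sub_mem (hvT j) (hST hpS)) hbT
  let c : ℝ → E d := fun θ => Real.cos θ • a + Real.sin θ • b
  have hcS (θ : ℝ) : c θ ∈ Sᗮ := Sᗮ.add_mem (Sᗮ.smul_mem _ haS)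
    (Sᗮ.smul_mem _ (Submodule.orthogonal_le hST hbT))
  have hca (θ : ℝ) : ‖a‖ = ‖c θ‖ :=
    (norm_smul_add_smul_of_inner_eq_zero hba hab (Real.cos_sq_add_sin_sq θ)).symm
  choose H hH using fun θ => exists_rot_eqOn (ℝ ∙ (a - c θ))ᗮ.reflection T
    ((finrank_span_range_le v).trans_lt hd)
  have hfix (θ : ℝ) {x : E d} (hx : x ∈ S) : rot (H θ) x = x := by
    rw [hH θ (hST hx), Submodule.reflection_mem_subspace_eq_self]
    exact Submodule.mem_orthogonal_singleton_iff_inner_left.2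
      (Submodule.inner_right_of_mem_orthogonal hx (Sᗮ.sub_mem haS (hcS θ)))
  have hmove (θ : ℝ) : rot (H θ) (v j) = p + c θ := by
    rw [← add_sub_cancel p (v j), rot, map_add]
    exact congrArg₂ _ (hfix θ hpS)
      ((hH θ (T.sub_mem (hvT j) (hST hpS))).trans (Submodule.reflection_sub (hca θ)))
  refine ⟨H, fun θ i hi => hfix θ (Submodule.subset_span (mem_image_of_mem v hi)), ?_, ?_⟩
  · simp only [hmove, c]
    fun_prop
  · intro θ θ'
    rw [hmove, hmove, add_sub_add_left_eq_sub, hdist]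
    exact norm_cos_smul_add_sin_smul_sub hba hab θ θ'

theorem simplexWidth_pos (hk : 1 ≤ k) (hv : LinearIndependent ℝ v) : 0 < simplexWidth v := by
  have : Nonempty (Fin k) := ⟨⟨0, hk⟩⟩
  obtain ⟨j, hj⟩ := exists_eq_ciInf_of_finite
    (f := fun j : Fin k => Metric.infDist (v j) (Submodule.span ℝ (v '' {j}ᶜ) : Set (E d)))
  rw [simplexWidth, ← hj, ← IsClosed.notMem_iff_infDist_pos
    (Submodule.closed_of_finiteDimensional _) ⟨0, Submodule.zero_mem _⟩]
  exact hv.notMem_span_image (by simp)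

theorem simplexWidth_le (v : Fin k → E d) (j : Fin k) :
    simplexWidth v ≤ Metric.infDist (v j) (Submodule.span ℝ (v '' {j}ᶜ) : Set (E d)) :=
  ciInf_le (Set.finite_range _).bddBelow j

/-- The multilinear form of which `simplexCount` is the diagonal. -/
def simplexForm (v : Fin k → E d) (l : ℝ) (f : E d → ℝ) (G : Fin k → E d → ℝ) : ℝ :=
  ∫ x, ∫ U, f x * ∏ i, G i (x - l • rot U (v i)) ∂haarSO d

theorem measurable_prod_comp_sub_smul_rot (v : Fin k → E d) (l : ℝ) {G : Fin k → E d → ℝ}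
    (hG : ∀ i, Measurable (G i)) (s : Finset (Fin k)) :
    Measurable fun p : E d × SO d => ∏ i ∈ s, G i (p.1 - l • rot p.2 (v i)) := by
  have hrot (i : Fin k) : Continuous fun p : E d × SO d => p.1 - l • rot p.2 (v i) := by fun_prop
  exact Finset.measurable_fun_prod _ fun i _ => (hG i).comp (hrot i).measurable

theorem isUnitBounded_mul_prod (v : Fin k → E d) (l : ℝ) {f : E d → ℝ} (hf : IsUnitBounded f)
    {G : Fin k → E d → ℝ} (hG : ∀ i, Measurable (G i)) (hG1 : ∀ i x, |G i x| ≤ 1)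
    (s : Finset (Fin k)) (U : SO d) :
    IsUnitBounded fun x => f x * ∏ i ∈ s, G i (x - l • rot U (v i)) := by
  refine hf.mul ((measurable_prod_comp_sub_smul_rot v l hG s).comp measurable_prodMk_right)
    fun x => ?_
  rw [Finset.abs_prod]
  exact Finset.prod_le_one (fun _ _ => abs_nonneg _) fun i _ => hG1 i _

theorem sq_simplexForm_le (hd : k + 1 ≤ d) (hv : 0 < simplexWidth v) {l : ℝ} (hl : 0 < l)
    {f : E d → ℝ} (hf : IsUnitBounded f) {G : Fin k → E d → ℝ} (hG : ∀ i, Measurable (G i))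
    (hG1 : ∀ i x, |G i x| ≤ 1) {j : Fin k} (hGj : IsUnitBounded (G j)) {κ : Measure (E d)}
    [IsProbabilityMeasure κ] {ρ : ℝ} (hρ : 0 ≤ ρ) (hκ : ∀ᵐ z ∂κ, ‖z‖ ≤ ρ) :
    simplexForm v l f G ^ 2 ≤
      (∫ x, (∫ z, G j (x - z) ∂κ) ^ 2) + chordConst d * √(ρ / (l * simplexWidth v)) := by
  obtain ⟨H, hfix, hcont, hchord⟩ := exists_rot_circle hd v j
  set r := Metric.infDist (v j) (Submodule.span ℝ (v '' {j}ᶜ) : Set (E d))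
  have hwr : simplexWidth v ≤ r := simplexWidth_le v j
  have hr : 0 < r := hv.trans_le hwr
  let Φ : E d → SO d → ℝ := fun x U =>
    f x * ∏ i ∈ Finset.univ.erase j, G i (x - l • rot U (v i))
  have hform : simplexForm v l f G = ∫ x, ∫ U, Φ x U * G j (x - rot U (l • v j)) ∂haarSO d := by
    simp only [simplexForm, Φ, mul_assoc, rot_smul, Finset.prod_erase_mul _ _ (Finset.mem_univ j)]
  have hΦ : Measurable (Function.uncurry Φ) := (hf.measurable.comp measurable_fst).mul
    (measurable_prod_comp_sub_smul_rot v l hG _)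
  have hΦH (x : E d) (U : SO d) (θ : ℝ) : Φ x (U * H θ) = Φ x U := by
    refine congrArg (f x * ·) (Finset.prod_congr rfl fun i hi => ?_)
    rw [rot_mul, hfix θ i (Finset.ne_of_mem_erase hi)]
  have hcont' : Continuous fun θ => rot (H θ) (l • v j) := by
    simp only [rot_smul]
    fun_prop
  have hchord' (θ θ' : ℝ) : ‖rot (H θ) (l • v j) - rot (H θ') (l • v j)‖ =
      |Real.sin ((θ - θ') / 2)| * (2 * (l * r)) := by
    rw [rot_smul, rot_smul, ← smul_sub, norm_smul, hchord, Real.norm_of_nonneg hl.le]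
    ring
  calc simplexForm v l f G ^ 2 ≤ chordMean (fun θ => rot (H θ) (l • v j)) (corr (G j)) :=
        hform ▸ hGj.sq_integral_le_chordMean_corr hΦ (isUnitBounded_mul_prod v l hf hG hG1 _)
          hΦH hcont'
    _ ≤ (∫ x, (∫ z, G j (x - z) ∂κ) ^ 2) + chordConst d * √(2 * ρ / (2 * (l * r))) :=
        hGj.chordMean_corr_le (by have := j.pos; omega) hκ hcont' (by positivity) hchord'
    _ ≤ (∫ x, (∫ z, G j (x - z) ∂κ) ^ 2) + chordConst d * √(ρ / (l * simplexWidth v)) := by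
        rw [mul_div_mul_left _ _ two_ne_zero]
        have := (chordConst_pos d).le
        gcongr

end VonNeumann

/-! ### Cubes -/

section Cubes

variable {d : ℕ}

theorem cube_eq_preimage (t : E d) (L : ℝ) : cube t L =
    (WithLp.ofLp : E d → Fin d → ℝ) ⁻¹' Icc (fun i => t i - L / 2) fun i => t i + L / 2 := by
  ext x
  simp only [cube, mem_ofPred_eq, mem_preimage, mem_Icc, Pi.le_def, ← forall_and]
  refine forall_congr' fun i => abs_le.trans ?_
  constructor <;> rintro ⟨h₁, h₂⟩ <;> constructor <;> linarith

theorem measurableSet_cube (t : E d) (L : ℝ) : MeasurableSet (cube t L) := by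
  rw [cube_eq_preimage]
  exact (PiLp.volume_preserving_ofLp (Fin d)).measurable measurableSet_Icc

theorem volume_cube (t : E d) (L : ℝ) : volume (cube t L) = ENNReal.ofReal L ^ d := by
  rw [cube_eq_preimage, (PiLp.volume_preserving_ofLp (Fin d)).measure_preimage
    measurableSet_Icc.nullMeasurableSet, Real.volume_Icc_pi]
  simp

theorem volume_cube_ne_top (t : E d) (L : ℝ) : volume (cube t L) ≠ ∞ := by
  simp [volume_cube]

theorem volume_real_cube (t : E d) {L : ℝ} (hL : 0 ≤ L) : volume.real (cube t L) = L ^ d := by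
  rw [measureReal_def, volume_cube, ENNReal.toReal_pow, ENNReal.toReal_ofReal hL]

theorem cube_subset_cube (t : E d) {L M : ℝ} (h : L ≤ M) : cube t L ⊆ cube t M :=
  fun _ hx i => (hx i).trans (by linarith)

theorem norm_le_of_mem_cube {L : ℝ} {z : E d} (hz : z ∈ cube (0 : E d) L) :
    ‖z‖ ≤ d * (L / 2) := by
  rw [← (EuclideanSpace.basisFun (Fin d) ℝ).sum_repr z]
  refine (norm_sum_le_of_le (n := fun _ => L / 2) _ fun i _ => ?_).trans_eq (by simp)
  simpa [norm_smul] using hz i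

/-- The centre of the unit cube. -/
def cubeCenter (d : ℕ) : E d := WithLp.toLp 2 fun _ => 1 / 2

theorem unitCube_eq_cube (d : ℕ) : unitCube d = cube (cubeCenter d) 1 := by
  ext x
  refine forall_congr' fun i => ?_
  simp only [cubeCenter, abs_le]
  constructor <;> rintro ⟨h₁, h₂⟩ <;> constructor <;> linarith

theorem measurableSet_unitCube (d : ℕ) : MeasurableSet (unitCube d) := by
  rw [unitCube_eq_cube]
  exact measurableSet_cube _ _

theorem volume_unitCube (d : ℕ) : volume (unitCube d) = 1 := by
  simp [unitCube_eq_cube, volume_cube]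

theorem volume_real_le_one {A : Set (E d)} (hA : A ⊆ unitCube d) : volume.real A ≤ 1 := by
  refine (measureReal_mono hA (by simp [volume_unitCube])).trans_eq ?_
  rw [measureReal_def, volume_unitCube, ENNReal.toReal_one]

theorem volume_real_cube_sdiff_le (t : E d) {a b : ℝ} (hb : 0 ≤ b) (hab : b ≤ a) :
    volume.real (cube t a \ cube t b) ≤ (a - b) * d * a ^ (d - 1) := by
  rw [measureReal_sdiff (cube_subset_cube t hab) (measurableSet_cube t b) (volume_cube_ne_top t a),
    volume_real_cube t hb, volume_real_cube t (hb.trans hab)]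
  have h := (le_abs_self _).trans (abs_pow_sub_pow_le a b d)
  rwa [abs_of_nonneg (sub_nonneg.2 hab), abs_of_nonneg hb, abs_of_nonneg (hb.trans hab),
    max_eq_left hab] at h

/-- The points whose cube of side `L` can meet both the unit cube and its complement. -/
def boundaryShell (d : ℕ) (L : ℝ) : Set (E d) :=
  cube (cubeCenter d) (1 + L) \ cube (cubeCenter d) (1 - L)

theorem measurableSet_boundaryShell (d : ℕ) (L : ℝ) : MeasurableSet (boundaryShell d L) :=
  (measurableSet_cube _ _).diff (measurableSet_cube _ _)

theorem integrable_indicator_boundaryShell (d : ℕ) (L : ℝ) :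
    Integrable ((boundaryShell d L).indicator fun _ => (1 : ℝ)) :=
  (integrable_indicator_iff (measurableSet_boundaryShell d L)).2 <| integrableOn_const <|
    measure_ne_top_of_subset sdiff_subset (volume_cube_ne_top _ _)

theorem volume_real_boundaryShell_le (d : ℕ) {L : ℝ} (hL : 0 ≤ L) (hL1 : L ≤ 1) :
    volume.real (boundaryShell d L) ≤ d * 2 ^ d * L := by
  obtain rfl | hd := Nat.eq_zero_or_pos d
  · simpa [boundaryShell] using volume_real_cube_sdiff_le (cubeCenter 0) (a := 1 + L) (b := 1 - L)
      (by linarith) (by linarith)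
  calc volume.real (boundaryShell d L) ≤ (1 + L - (1 - L)) * d * (1 + L) ^ (d - 1) :=
        volume_real_cube_sdiff_le _ (by linarith) (by linarith)
    _ ≤ (1 + L - (1 - L)) * d * 2 ^ (d - 1) := by
        have hwidth : 0 ≤ 1 + L - (1 - L) := by linarith
        gcongr
        linarith
    _ = d * (2 * 2 ^ (d - 1)) * L := by ring
    _ = d * 2 ^ d * L := by rw [mul_pow_sub_one hd.ne']

theorem indicator_one_mem_Icc {X : Type*} (A : Set X) (x : X) :
    A.indicator (fun _ => (1 : ℝ)) x ∈ Icc (0 : ℝ) 1 := by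
  by_cases h : x ∈ A <;> simp [h]

theorem isUnitBounded_of_abs_le {f : E d → ℝ} (hf : Measurable f)
    (h : ∀ x, |f x| ≤ (unitCube d).indicator (fun _ => (1 : ℝ)) x) : IsUnitBounded f := by
  have hint : Integrable ((unitCube d).indicator fun _ => (1 : ℝ)) :=
    (integrable_indicator_iff (measurableSet_unitCube d)).2
      (integrableOn_const (by simp [volume_unitCube]))
  have hfint : Integrable f := hint.mono' hf.aestronglyMeasurable (ae_of_all _ h)
  refine ⟨hf, fun x => (h x).trans (indicator_one_mem_Icc _ x).2, hfint, ?_⟩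
  refine (integral_mono hfint.abs hint h).trans ?_
  rw [integral_indicator_const _ (measurableSet_unitCube d), smul_eq_mul, mul_one]
  exact volume_real_le_one subset_rfl

theorem isUnitBounded_indicator {A : Set (E d)} (hA : MeasurableSet A) (hAQ : A ⊆ unitCube d) :
    IsUnitBounded (A.indicator fun _ => (1 : ℝ)) := by
  refine isUnitBounded_of_abs_le (measurable_const.indicator hA) fun x => ?_
  rw [abs_of_nonneg (indicator_one_mem_Icc A x).1]
  exact indicator_le_indicator_of_subset hAQ (fun _ => zero_le_one) x

/-- The balanced function `1_A - |A| 1_{[0,1]^d}`, of integral zero when `A ⊆ [0,1]^d`. -/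
def balanced (A : Set (E d)) (x : E d) : ℝ :=
  A.indicator (fun _ => (1 : ℝ)) x - volume.real A * (unitCube d).indicator (fun _ => (1 : ℝ)) x

theorem isUnitBounded_balanced {A : Set (E d)} (hA : MeasurableSet A) (hAQ : A ⊆ unitCube d) :
    IsUnitBounded (balanced A) := by
  refine isUnitBounded_of_abs_le ((measurable_const.indicator hA).sub
    ((measurable_const.indicator (measurableSet_unitCube d)).const_mul _)) fun x => ?_
  have hα1 := volume_real_le_one hAQ
  have hα0 : 0 ≤ volume.real A := measureReal_nonneg
  have hA01 := indicator_one_mem_Icc A x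
  by_cases hx : x ∈ unitCube d
  · rw [balanced, indicator_of_mem hx, mul_one, abs_le]
    constructor <;> linarith [hA01.1, hA01.2]
  · simp [balanced, hx, notMem_subset hAQ hx]

end Cubes

/-! ### Densities in cubes -/

section CubeDensity

variable {d : ℕ} {A : Set (E d)} {L : ℝ}

/-- The uniform probability measure on the cube of side `L` centred at the origin. -/
def cubeMeasure (d : ℕ) (L : ℝ) : Measure (E d) := ProbabilityTheory.cond volume (cube (0 : E d) L)

theorem isProbabilityMeasure_cubeMeasure (d : ℕ) (hL : 0 < L) :
    IsProbabilityMeasure (cubeMeasure d L) := by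
  refine ProbabilityTheory.cond_isProbabilityMeasure_of_finite ?_ (volume_cube_ne_top 0 L)
  rw [volume_cube]
  exact (ENNReal.pow_pos (ENNReal.ofReal_pos.2 hL) d).ne'

theorem ae_cubeMeasure_norm_le (d : ℕ) (L : ℝ) : ∀ᵐ z ∂cubeMeasure d L, ‖z‖ ≤ d * (L / 2) :=
  (ProbabilityTheory.ae_cond_mem (measurableSet_cube 0 L)).mono fun _ => norm_le_of_mem_cube

/-- The density of `A` in the cube of side `L` centred at `t`. -/
def cubeDensity (A : Set (E d)) (t : E d) (L : ℝ) : ℝ :=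
  volume.real (A ∩ cube t L) / volume.real (cube (0 : E d) L)

theorem cubeDensity_congr {B : Set (E d)} (h : A =ᵐ[volume] B) (t : E d) (L : ℝ) :
    cubeDensity A t L = cubeDensity B t L := by
  rw [cubeDensity, cubeDensity, measureReal_congr (h.inter (ae_eq_refl (cube t L)))]

theorem cubeDensity_mem_Icc (A : Set (E d)) (t : E d) (L : ℝ) :
    cubeDensity A t L ∈ Icc (0 : ℝ) 1 := by
  refine ⟨div_nonneg measureReal_nonneg measureReal_nonneg,
    div_le_one_of_le₀ ?_ measureReal_nonneg⟩
  refine (measureReal_mono inter_subset_right (volume_cube_ne_top t L)).trans_eq ?_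
  simp only [measureReal_def, volume_cube]

theorem cubeDensity_eq_zero (hAQ : A ⊆ unitCube d) {x : E d}
    (hx : x ∉ cube (cubeCenter d) (1 + L)) : cubeDensity A x L = 0 := by
  have hdisj : A ∩ cube x L = ∅ := by
    refine eq_empty_of_forall_notMem fun y ⟨hyA, hyx⟩ => hx fun i => ?_
    have hyQ := hAQ hyA
    rw [unitCube_eq_cube] at hyQ
    have hyQi := abs_le.1 (hyQ i)
    have hyxi := abs_le.1 (hyx i)
    rw [abs_le]
    constructor <;> linarith
  simp [cubeDensity, hdisj]

theorem cubeDensity_unitCube (hL : 0 < L) {x : E d} (hx : x ∈ cube (cubeCenter d) (1 - L)) :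
    cubeDensity (unitCube d) x L = 1 := by
  have hsub : cube x L ⊆ unitCube d := fun y hy => by
    rw [unitCube_eq_cube]
    intro i
    have hxi := abs_le.1 (hx i)
    have hyi := abs_le.1 (hy i)
    rw [abs_le]
    constructor <;> linarith
  rw [cubeDensity, inter_eq_right.2 hsub, volume_real_cube x hL.le, volume_real_cube 0 hL.le,
    div_self (by positivity)]

theorem integral_cubeMeasure_indicator (hA : MeasurableSet A) (x : E d) :
    ∫ z, A.indicator (fun _ => (1 : ℝ)) (x - z) ∂cubeMeasure d L = cubeDensity A x L := by
  have hmp : MeasurePreserving (fun z : E d => x - z) := Measure.measurePreserving_sub_left volume x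
  have hpre : cube (0 : E d) L ∩ (fun z : E d => x - z) ⁻¹' A =
      (fun z : E d => x - z) ⁻¹' (A ∩ cube x L) := by
    ext z
    simp [cube, and_comm]
  calc ∫ z, A.indicator (fun _ => (1 : ℝ)) (x - z) ∂cubeMeasure d L
      = (cubeMeasure d L).real ((fun z : E d => x - z) ⁻¹' A) := by
        rw [← integral_indicator_one (hmp.measurable hA)]
        rfl
    _ = (volume.real (cube (0 : E d) L))⁻¹ * volume.real (A ∩ cube x L) := by
        rw [measureReal_def, cubeMeasure, ProbabilityTheory.cond_apply (measurableSet_cube 0 L),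
          hpre, hmp.measure_preimage (hA.inter (measurableSet_cube x L)).nullMeasurableSet,
          ENNReal.toReal_mul, ENNReal.toReal_inv]
        rfl
    _ = cubeDensity A x L := (div_eq_inv_mul _ _).symm

theorem integral_cubeMeasure_balanced (hA : MeasurableSet A) (hAQ : A ⊆ unitCube d) (hL : 0 < L)
    (x : E d) : ∫ z, balanced A (x - z) ∂cubeMeasure d L =
      cubeDensity A x L - volume.real A * cubeDensity (unitCube d) x L := by
  have := isProbabilityMeasure_cubeMeasure d hL
  have hint {S : Set (E d)} (hS : MeasurableSet S) (hSQ : S ⊆ unitCube d) :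
      Integrable (fun z => S.indicator (fun _ => (1 : ℝ)) (x - z)) (cubeMeasure d L) :=
    .of_bound (C := 1) ((isUnitBounded_indicator hS hSQ).measurable.comp
      (measurable_const.sub measurable_id)).aestronglyMeasurable
      (ae_of_all _ fun z => (isUnitBounded_indicator hS hSQ).abs_le _)
  have hQ := measurableSet_unitCube d
  simp only [balanced]
  rw [integral_sub (hint hA hAQ) ((hint hQ subset_rfl).const_mul _), integral_const_mul,
    integral_cubeMeasure_indicator hA, integral_cubeMeasure_indicator hQ]

theorem measurable_indicator_sub (hA : MeasurableSet A) :
    Measurable (Function.uncurry fun x z : E d => A.indicator (fun _ => (1 : ℝ)) (x - z)) :=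
  (measurable_const.indicator hA).comp (measurable_fst.sub measurable_snd)

theorem isUnitBounded_cubeDensity (hA : MeasurableSet A) (hAQ : A ⊆ unitCube d) (hL : 0 < L) :
    IsUnitBounded fun x => cubeDensity A x L := by
  have := isProbabilityMeasure_cubeMeasure d hL
  simp only [← integral_cubeMeasure_indicator hA]
  exact IsUnitBounded.integral (measurable_indicator_sub hA)
    fun z => (isUnitBounded_indicator hA hAQ).comp_sub_right z

theorem integral_cubeDensity (hA : MeasurableSet A) (hAQ : A ⊆ unitCube d) (hL : 0 < L) :
    ∫ x, cubeDensity A x L = volume.real A := by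
  have := isProbabilityMeasure_cubeMeasure d hL
  simp only [← integral_cubeMeasure_indicator hA]
  rw [integral_integral_swap (IsUnitBounded.integrable_uncurry (measurable_indicator_sub hA)
    fun z => (isUnitBounded_indicator hA hAQ).comp_sub_right z)]
  simp only [integral_sub_right_eq_self (A.indicator fun _ => (1 : ℝ)),
    integral_indicator_const _ hA, integral_const, probReal_univ, smul_eq_mul, mul_one, one_mul]

theorem integrable_indicator_sq_cubeDensity_sub (hA : MeasurableSet A) (hAQ : A ⊆ unitCube d)
    (hL : 0 < L) : Integrable
      ((unitCube d).indicator fun x => |cubeDensity A x L - volume.real A| ^ 2) := by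
  refine (isUnitBounded_of_abs_le ?_ fun x => ?_).integrable
  · exact (((isUnitBounded_cubeDensity hA hAQ hL).measurable.sub_const _).abs.pow_const 2).indicator
      (measurableSet_unitCube d)
  · have hg := cubeDensity_mem_Icc A x L
    have hα := volume_real_le_one hAQ
    have hα0 : 0 ≤ volume.real A := measureReal_nonneg
    by_cases hx : x ∈ unitCube d
    · rw [indicator_of_mem hx, indicator_of_mem hx, abs_pow, abs_abs]
      exact pow_le_one₀ (abs_nonneg _) (abs_le.2 ⟨by linarith [hg.1], by linarith [hg.2]⟩)
    · simp [hx]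

theorem sq_integral_cubeMeasure_balanced_le (hA : MeasurableSet A) (hAQ : A ⊆ unitCube d)
    (hL : 0 < L) (x : E d) :
    (∫ z, balanced A (x - z) ∂cubeMeasure d L) ^ 2 ≤
      (unitCube d).indicator (fun t => |cubeDensity A t L - volume.real A| ^ 2) x +
        (boundaryShell d L).indicator (fun _ => (1 : ℝ)) x := by
  rw [integral_cubeMeasure_balanced hA hAQ hL]
  have hindQ : 0 ≤ (unitCube d).indicator (fun t => |cubeDensity A t L - volume.real A| ^ 2) x :=
    indicator_nonneg (fun _ _ => by positivity) x
  have hindS := (indicator_one_mem_Icc (boundaryShell d L) x).1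
  by_cases hin : x ∈ cube (cubeCenter d) (1 - L)
  · have hxQ : x ∈ unitCube d := by
      rw [unitCube_eq_cube]
      exact cube_subset_cube _ (by linarith) hin
    rw [cubeDensity_unitCube hL hin, mul_one, indicator_of_mem hxQ, sq_abs]
    exact le_add_of_nonneg_right hindS
  by_cases hout : x ∈ cube (cubeCenter d) (1 + L)
  · rw [indicator_of_mem (show x ∈ boundaryShell d L from ⟨hout, hin⟩)]
    refine le_add_of_nonneg_of_le hindQ ((sq_le_one_iff_abs_le_one _).2 (abs_le.2 ?_))
    have hα0 : 0 ≤ volume.real A := measureReal_nonneg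
    have hα1 := volume_real_le_one hAQ
    obtain ⟨hA0, hA1⟩ := cubeDensity_mem_Icc A x L
    obtain ⟨hQ0, hQ1⟩ := cubeDensity_mem_Icc (unitCube d) x L
    constructor <;> nlinarith
  · rw [cubeDensity_eq_zero hAQ hout, cubeDensity_eq_zero subset_rfl hout]
    simpa using add_nonneg hindQ hindS

theorem integral_sq_balanced_le {ε : ℝ} (hA : MeasurableSet A) (hL : 0 < L) (hL1 : L ≤ 1)
    (hu : IsUniformlyDistributed ε L A) :
    ∫ x, (∫ z, balanced A (x - z) ∂cubeMeasure d L) ^ 2 ≤ ε ^ 2 + d * 2 ^ d * L := by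
  have hintQ := integrable_indicator_sq_cubeDensity_sub hA hu.1 hL
  have hintS := integrable_indicator_boundaryShell d L
  calc ∫ x, (∫ z, balanced A (x - z) ∂cubeMeasure d L) ^ 2
      ≤ ∫ x, ((unitCube d).indicator (fun t => |cubeDensity A t L - volume.real A| ^ 2) x +
          (boundaryShell d L).indicator (fun _ => (1 : ℝ)) x) :=
        integral_mono_of_nonneg (ae_of_all _ fun x => sq_nonneg _) (hintQ.add hintS)
          (ae_of_all _ (sq_integral_cubeMeasure_balanced_le hA hu.1 hL))
    _ = (∫ t in unitCube d, |cubeDensity A t L - volume.real A| ^ 2) +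
          volume.real (boundaryShell d L) := by
        rw [integral_add hintQ hintS, integral_indicator (measurableSet_unitCube d),
          integral_indicator_const _ (measurableSet_boundaryShell d L), smul_eq_mul, mul_one]
    _ ≤ ε ^ 2 + d * 2 ^ d * L := add_le_add hu.2 (volume_real_boundaryShell_le d hL.le hL1)

end CubeDensity

/-! ### Counting simplices in uniformly distributed sets -/

section SimplexForm

variable {d k : ℕ} {v : Fin k → E d} {A : Set (E d)} {l : ℝ}

theorem integrable_simplexForm_integrand (v : Fin k → E d) (l : ℝ) {f : E d → ℝ}
    (hf : IsUnitBounded f) {G : Fin k → E d → ℝ} (hG : ∀ i, Measurable (G i))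
    (hG1 : ∀ i x, |G i x| ≤ 1) :
    Integrable (Function.uncurry fun x U => f x * ∏ i, G i (x - l • rot U (v i)))
      (volume.prod (haarSO d)) :=
  IsUnitBounded.integrable_uncurry ((hf.measurable.comp measurable_fst).mul
    (measurable_prod_comp_sub_smul_rot v l hG _)) (isUnitBounded_mul_prod v l hf hG hG1 _)

theorem prod_update_apply {ι X M : Type*} [Fintype ι] [DecidableEq ι] [CommMonoid M]
    (G : ι → X → M) (j : ι) (g : X → M) (p : ι → X) :
    ∏ i, Function.update G j g i (p i) = g (p j) * ∏ i ∈ Finset.univ \ {j}, G i (p i) := by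
  simp only [Function.apply_update fun i (φ : X → M) => φ (p i)]
  exact Finset.prod_update_of_mem (Finset.mem_univ j) _ _

theorem simplexForm_update_sub (v : Fin k → E d) (l : ℝ) {f : E d → ℝ} (hf : IsUnitBounded f)
    {G : Fin k → E d → ℝ} (hG : ∀ i, Measurable (G i)) (hG1 : ∀ i x, |G i x| ≤ 1) (j : Fin k)
    {g h : E d → ℝ} (hg : Measurable g) (hg1 : ∀ x, |g x| ≤ 1) (hh : Measurable h)
    (hh1 : ∀ x, |h x| ≤ 1) :
    simplexForm v l f (Function.update G j g) - simplexForm v l f (Function.update G j h) =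
      simplexForm v l f (Function.update G j (g - h)) := by
  have hint {φ : E d → ℝ} (hφ : Measurable φ) (hφ1 : ∀ x, |φ x| ≤ 1) :=
    integrable_simplexForm_integrand v l hf (G := Function.update G j φ)
      ((Function.forall_update_iff G fun _ φ => Measurable φ).2 ⟨hφ, fun i _ => hG i⟩)
      ((Function.forall_update_iff G fun _ φ => ∀ x, |φ x| ≤ 1).2 ⟨hφ1, fun i _ => hG1 i⟩)
  refine (integral_integral_sub (hint hg hg1) (hint hh hh1)).symm.trans ?_
  simp only [simplexForm, Function.uncurry_apply_pair, prod_update_apply, Pi.sub_apply, sub_mul,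
    mul_sub]

/-- The family interpolating between `1_A` (for `m = 0`) and `|A| 1_{[0,1]^d}` (for `m = k`): the
first `m` functions are the latter, the others the former. -/
def hybrid (A : Set (E d)) (m : ℕ) (i : Fin k) : E d → ℝ :=
  if i.1 < m then fun x => volume.real A * (unitCube d).indicator (fun _ => (1 : ℝ)) x
  else A.indicator fun _ => (1 : ℝ)

theorem hybrid_of_lt (A : Set (E d)) {m : ℕ} {i : Fin k} (h : i.1 < m) :
    hybrid A m i = fun x => volume.real A * (unitCube d).indicator (fun _ => (1 : ℝ)) x :=
  if_pos h

theorem hybrid_of_le (A : Set (E d)) {m : ℕ} {i : Fin k} (h : m ≤ i.1) :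
    hybrid A m i = A.indicator fun _ => (1 : ℝ) :=
  if_neg h.not_gt

theorem hybrid_succ (A : Set (E d)) (j : Fin k) : hybrid A (j.1 + 1) =
    Function.update (hybrid A j.1) j
      fun x => volume.real A * (unitCube d).indicator (fun _ => (1 : ℝ)) x := by
  funext i
  obtain rfl | hij := eq_or_ne i j
  · rw [Function.update_self, hybrid_of_lt A (Nat.lt_succ_self _)]
  · have hiff : i.1 < j.1 + 1 ↔ i.1 < j.1 := by
      have := Fin.val_ne_of_ne hij
      omega
    simp only [Function.update_of_ne hij, hybrid, hiff]

theorem measurable_hybrid (hA : MeasurableSet A) (m : ℕ) (i : Fin k) :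
    Measurable (hybrid A m i) := by
  unfold hybrid
  split_ifs
  · exact (measurable_const.indicator (measurableSet_unitCube d)).const_mul _
  · exact measurable_const.indicator hA

theorem hybrid_mem_Icc (hAQ : A ⊆ unitCube d) (m : ℕ) (i : Fin k) (x : E d) :
    hybrid A m i x ∈ Icc (0 : ℝ) 1 := by
  unfold hybrid
  split_ifs
  · have hQ := indicator_one_mem_Icc (unitCube d) x
    exact ⟨mul_nonneg measureReal_nonneg hQ.1, mul_le_one₀ (volume_real_le_one hAQ) hQ.1 hQ.2⟩
  · exact indicator_one_mem_Icc A x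

theorem abs_hybrid_le (hAQ : A ⊆ unitCube d) (m : ℕ) (i : Fin k) (x : E d) :
    |hybrid A m i x| ≤ 1 :=
  have h := hybrid_mem_Icc hAQ m i x
  abs_le.2 ⟨by linarith [h.1], h.2⟩

theorem simplexForm_hybrid_sub_succ (v : Fin k → E d) (l : ℝ) (hA : MeasurableSet A)
    (hAQ : A ⊆ unitCube d) (j : Fin k) :
    simplexForm v l (A.indicator fun _ => (1 : ℝ)) (hybrid A j.1) -
        simplexForm v l (A.indicator fun _ => (1 : ℝ)) (hybrid A (j.1 + 1)) =
      simplexForm v l (A.indicator fun _ => (1 : ℝ))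
        (Function.update (hybrid A j.1) j (balanced A)) := by
  have hsub := simplexForm_update_sub v l (isUnitBounded_indicator hA hAQ)
    (measurable_hybrid hA j.1) (abs_hybrid_le hAQ j.1) j
    (measurable_hybrid hA j.1 j) (abs_hybrid_le hAQ j.1 j)
    (measurable_hybrid hA (j.1 + 1) j) (abs_hybrid_le hAQ (j.1 + 1) j)
  rwa [Function.update_eq_self, hybrid_of_lt A (Nat.lt_succ_self _), ← hybrid_succ,
    hybrid_of_le A le_rfl] at hsub

/-- The bound for `simplexForm` when one of its entries is the balanced function of an
`(ε, L)`-uniformly distributed set and the simplex has width at least `c`. -/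
def balancedFormBound (d : ℕ) (c l ε L : ℝ) : ℝ :=
  √(ε ^ 2 + d * 2 ^ d * L + chordConst d * √(d * (L / 2) / (l * c)))

variable {c ε L : ℝ}

theorem abs_simplexForm_hybrid_sub_succ_le (hd : k + 1 ≤ d) (hc : 0 < c) (hcv : c ≤ simplexWidth v)
    (hl : 0 < l) (hA : MeasurableSet A) (hL : 0 < L) (hL1 : L ≤ 1)
    (hu : IsUniformlyDistributed ε L A) (j : Fin k) :
    |simplexForm v l (A.indicator fun _ => (1 : ℝ)) (hybrid A j.1) -
        simplexForm v l (A.indicator fun _ => (1 : ℝ)) (hybrid A (j.1 + 1))| ≤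
      balancedFormBound d c l ε L := by
  have := isProbabilityMeasure_cubeMeasure d hL
  have hbal := isUnitBounded_balanced hA hu.1
  have hself : Function.update (hybrid A j.1) j (balanced A) j = balanced A :=
    Function.update_self ..
  have hform := sq_simplexForm_le hd (hc.trans_le hcv) hl (isUnitBounded_indicator hA hu.1)
    (G := Function.update (hybrid A j.1) j (balanced A))
    ((Function.forall_update_iff _ fun _ (φ : E d → ℝ) => Measurable φ).2
      ⟨hbal.measurable, fun i _ => measurable_hybrid hA j.1 i⟩)
    ((Function.forall_update_iff _ fun _ (φ : E d → ℝ) => ∀ x, |φ x| ≤ 1).2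
      ⟨hbal.abs_le, fun i _ => abs_hybrid_le hu.1 j.1 i⟩)
    (j := j) (by rwa [hself]) (by positivity) (ae_cubeMeasure_norm_le d L)
  rw [hself] at hform
  rw [simplexForm_hybrid_sub_succ v l hA hu.1]
  refine Real.abs_le_sqrt (hform.trans ?_)
  have := (chordConst_pos d).le
  gcongr
  exact integral_sq_balanced_le hA hL hL1 hu

theorem abs_simplexCount_sub_simplexForm_hybrid_le (hd : k + 1 ≤ d) (hc : 0 < c)
    (hcv : c ≤ simplexWidth v) (hl : 0 < l) (hA : MeasurableSet A) (hL : 0 < L) (hL1 : L ≤ 1)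
    (hu : IsUniformlyDistributed ε L A) :
    |simplexCount A v l - simplexForm v l (A.indicator fun _ => (1 : ℝ)) (hybrid A k)| ≤
      k * balancedFormBound d c l ε L := by
  have htele := dist_le_range_sum_of_dist_le
    (f := fun m => simplexForm v l (A.indicator fun _ => (1 : ℝ)) (hybrid A m)) k
    fun {m} hm => abs_simplexForm_hybrid_sub_succ_le hd hc hcv hl hA hL hL1 hu ⟨m, hm⟩
  have hzero : (hybrid A 0 : Fin k → E d → ℝ) = fun _ => A.indicator fun _ => (1 : ℝ) :=
    funext fun i => hybrid_of_le A (Nat.zero_le _)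
  simp only [Real.dist_eq, Finset.sum_const, Finset.card_range, nsmul_eq_mul, hzero] at htele
  exact htele

theorem sub_mem_unitCube {r : ℝ} {x w : E d} (hx : x ∈ cube (cubeCenter d) (1 - 2 * r))
    (hw : ‖w‖ ≤ r) : x - w ∈ unitCube d := by
  rw [unitCube_eq_cube]
  intro i
  have hxi := abs_le.1 (hx i)
  have hwi := abs_le.1 ((PiLp.norm_apply_le w i).trans hw)
  rw [PiLp.sub_apply, abs_le]
  constructor <;> linarith

theorem volume_real_unitCube_sdiff_cube_le (hd : 1 ≤ d) {s : ℝ} (hs : 0 ≤ s) :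
    volume.real (unitCube d \ cube (cubeCenter d) (1 - s)) ≤ d * s := by
  rcases le_or_gt s 1 with hs1 | hs1
  · rw [unitCube_eq_cube]
    refine (volume_real_cube_sdiff_le _ (by linarith) (by linarith)).trans_eq ?_
    rw [one_pow]
    ring
  · have hd1 : (1 : ℝ) ≤ d := mod_cast hd
    exact (volume_real_le_one sdiff_subset).trans (one_le_mul_of_one_le_of_one_le hd1 hs1.le)

theorem abs_indicator_mul_prod_hybrid_sub_le (hAQ : A ⊆ unitCube d) {R : ℝ} (hvR : ∀ j, ‖v j‖ ≤ R)
    (hl : 0 ≤ l) (x : E d) (U : SO d) :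
    |A.indicator (fun _ => (1 : ℝ)) x * ∏ i, hybrid A k i (x - l • rot U (v i)) -
        volume.real A ^ k * A.indicator (fun _ => (1 : ℝ)) x| ≤
      (unitCube d \ cube (cubeCenter d) (1 - 2 * (l * R))).indicator (fun _ => (1 : ℝ)) x := by
  by_cases hxA : x ∈ A
  swap
  · simpa [hxA] using (indicator_one_mem_Icc _ x).1
  rw [indicator_of_mem hxA, one_mul, mul_one]
  by_cases hx : x ∈ cube (cubeCenter d) (1 - 2 * (l * R))
  · have hmem (i : Fin k) : x - l • rot U (v i) ∈ unitCube d := by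
      refine sub_mem_unitCube hx ?_
      rw [norm_smul, norm_rot, Real.norm_of_nonneg hl]
      exact mul_le_mul_of_nonneg_left (hvR i) hl
    simp only [hybrid_of_lt A (Fin.is_lt _), indicator_of_mem (hmem _), mul_one, Finset.prod_const,
      Finset.card_univ, Fintype.card_fin, sub_self, abs_zero]
    exact (indicator_one_mem_Icc _ x).1
  · rw [indicator_of_mem (show x ∈ unitCube d \ _ from ⟨hAQ hxA, hx⟩)]
    have hhyb (i : Fin k) := hybrid_mem_Icc hAQ k i (x - l • rot U (v i))
    exact abs_sub_le_of_nonneg_of_le (Finset.prod_nonneg fun i _ => (hhyb i).1)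
      (Finset.prod_le_one (fun i _ => (hhyb i).1) fun i _ => (hhyb i).2)
      (pow_nonneg measureReal_nonneg k)
      (pow_le_one₀ measureReal_nonneg (volume_real_le_one hAQ))

theorem abs_simplexForm_hybrid_sub_pow_le (hd : 1 ≤ d) {R : ℝ} (hR : 0 ≤ R)
    (hvR : ∀ j, ‖v j‖ ≤ R) (hl : 0 ≤ l) (hA : MeasurableSet A) (hAQ : A ⊆ unitCube d) :
    |simplexForm v l (A.indicator fun _ => (1 : ℝ)) (hybrid A k) - volume.real A ^ (k + 1)| ≤
      d * (2 * (l * R)) := by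
  let B := unitCube d \ cube (cubeCenter d) (1 - 2 * (l * R))
  have hB : MeasurableSet B := (measurableSet_unitCube d).diff (measurableSet_cube _ _)
  have hind := isUnitBounded_indicator hA hAQ
  have hmain : Integrable (Function.uncurry fun (x : E d) (_ : SO d) =>
      volume.real A ^ k * A.indicator (fun _ => (1 : ℝ)) x) (volume.prod (haarSO d)) :=
    (hind.integrable.const_mul _).comp_fst _
  have hpow : volume.real A ^ (k + 1) =
      ∫ x, ∫ _, volume.real A ^ k * A.indicator (fun _ => (1 : ℝ)) x ∂haarSO d := by
    simp only [integral_const, probReal_univ, integral_const_mul,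
      integral_indicator_const _ hA, smul_eq_mul, one_mul, mul_one, pow_succ]
  have hform := integrable_simplexForm_integrand v l hind (measurable_hybrid hA k)
    (abs_hybrid_le hAQ k)
  rw [hpow, simplexForm, integral_integral hform, integral_integral hmain]
  have hBint : Integrable (fun p : E d × SO d => B.indicator (fun _ => (1 : ℝ)) p.1)
      (volume.prod (haarSO d)) := (isUnitBounded_indicator hB sdiff_subset).integrable.comp_fst _
  refine (congrArg norm (integral_sub hform hmain)).symm.trans_le ?_
  refine (norm_integral_le_of_norm_le hBint (ae_of_all _ fun p =>
    abs_indicator_mul_prod_hybrid_sub_le hAQ hvR hl p.1 p.2)).trans ?_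
  rw [integral_fun_fst, probReal_univ, one_smul, integral_indicator_const _ hB, smul_eq_mul,
    mul_one]
  exact volume_real_unitCube_sdiff_cube_le hd (by positivity)

theorem abs_simplexCount_sub_pow_le (hd : k + 1 ≤ d) {R : ℝ} (hR : 0 ≤ R) (hvR : ∀ j, ‖v j‖ ≤ R)
    (hc : 0 < c) (hcv : c ≤ simplexWidth v) (hl : 0 < l) (hA : MeasurableSet A) (hL : 0 < L)
    (hL1 : L ≤ 1) (hu : IsUniformlyDistributed ε L A) :
    |simplexCount A v l - volume.real A ^ (k + 1)| ≤
      k * balancedFormBound d c l ε L + d * (2 * (l * R)) :=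
  (abs_sub_le _ _ _).trans <| add_le_add
    (abs_simplexCount_sub_simplexForm_hybrid_le hd hc hcv hl hA hL hL1 hu)
    (abs_simplexForm_hybrid_sub_pow_le (by omega) hR hvR hl.le hA hu.1)

end SimplexForm

section SimplexCount

variable {d k : ℕ} {v : Fin k → E d} {A B : Set (E d)} {l : ℝ}

theorem abs_simplexCount_le_one (v : Fin k → E d) (l : ℝ) (hA : MeasurableSet A)
    (hAQ : A ⊆ unitCube d) : |simplexCount A v l| ≤ 1 := by
  have hind := isUnitBounded_indicator hA hAQ
  have hint := IsUnitBounded.integral (P := haarSO d)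
    ((hind.measurable.comp measurable_fst).mul
      (measurable_prod_comp_sub_smul_rot v l (fun _ => hind.measurable) Finset.univ))
    (isUnitBounded_mul_prod v l hind (fun _ => hind.measurable) (fun _ => hind.abs_le) _)
  exact hint.abs_integral_le

theorem containsCopy_of_simplexCount_ne_zero (hd : k + 1 ≤ d) (h : simplexCount A v l ≠ 0) :
    ContainsCopy A l (simplex v) := by
  obtain ⟨x, U, hxU⟩ : ∃ (x : E d) (U : SO d), A.indicator (fun _ => (1 : ℝ)) x *
      ∏ j, A.indicator (fun _ => (1 : ℝ)) (x - l • rot U (v j)) ≠ 0 := by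
    by_contra! hzero
    exact h (by simp only [simplexCount, hzero, integral_zero])
  obtain ⟨S, hS⟩ := exists_rot_eq_neg hd v
  refine ⟨x, U * S, ?_⟩
  rintro _ ⟨p, rfl | ⟨j, rfl⟩, rfl⟩
  · have hx := mem_of_indicator_ne_zero (left_ne_zero_of_mul hxU)
    simpa only [rot, map_zero, smul_zero, add_zero] using hx
  · have hxj := mem_of_indicator_ne_zero
      (Finset.prod_ne_zero_iff.1 (right_ne_zero_of_mul hxU) j (Finset.mem_univ j))
    simpa only [rot_mul, hS, rot_neg, smul_neg, sub_eq_add_neg] using hxj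

theorem containsCopy_of_abs_simplexCount_sub_pow_lt (hd : k + 1 ≤ d)
    (h : |simplexCount A v l - volume.real A ^ (k + 1)| < volume.real A ^ (k + 1)) :
    ContainsCopy A l (simplex v) := by
  refine containsCopy_of_simplexCount_ne_zero hd fun hzero => ?_
  rw [hzero, zero_sub, abs_neg] at h
  exact h.not_ge (le_abs_self _)

theorem ContainsCopy.mono {Δ : Set (E d)} (h : ContainsCopy A l Δ) (hAB : A ⊆ B) :
    ContainsCopy B l Δ := by
  obtain ⟨x, U, hxU⟩ := h
  exact ⟨x, U, hxU.trans hAB⟩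

theorem quasiMeasurePreserving_sub_smul_rot (l : ℝ) (w : E d) :
    Measure.QuasiMeasurePreserving (fun p : E d × SO d => p.1 - l • rot p.2 w)
      (volume.prod (haarSO d)) := by
  have hcont : Continuous fun p : E d × SO d => p.1 - l • rot p.2 w := by fun_prop
  exact QuasiMeasurePreserving.prod_of_left hcont.measurable (ae_of_all _ fun U =>
    (measurePreserving_sub_right volume (l • rot U w)).quasiMeasurePreserving)

theorem simplexCount_congr (v : Fin k → E d) (l : ℝ) (h : A =ᵐ[volume] B) :
    simplexCount A v l = simplexCount B v l := by
  have hind := indicator_ae_eq_of_ae_eq_set (f := fun _ : E d => (1 : ℝ)) h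
  have hvertex := Measure.ae_ae_of_ae_prod (ae_all_iff.2 fun j =>
    (quasiMeasurePreserving_sub_smul_rot l (v j)).ae hind)
  refine integral_congr_ae ?_
  filter_upwards [hind, hvertex] with x hx hvertex
  refine integral_congr_ae ?_
  filter_upwards [hvertex] with U hU
  rw [hx, Finset.prod_congr rfl fun j _ => hU j]

theorem IsUniformlyDistributed.congr {ε L : ℝ} (hB : IsUniformlyDistributed ε L B) (hAB : A ⊆ B)
    (h : A =ᵐ[volume] B) : IsUniformlyDistributed ε L A := by
  refine ⟨hAB.trans hB.1, le_of_eq_of_le ?_ hB.2⟩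
  refine congrArg (fun F : E d → ℝ => ∫ t in unitCube d, F t) (funext fun t => ?_)
  exact congrArg₂ (fun a b : ℝ => |a - b| ^ 2) (cubeDensity_congr h t L) (measureReal_congr h)

end SimplexCount

section CountingEstimate

variable {d k : ℕ} {v : Fin k → E d} {A : Set (E d)} {c ε l R : ℝ}

theorem rpow_mul_rpow_pow_six (hc : 0 ≤ c) (hε : 0 ≤ ε) :
    (c ^ (-(1 / 6) : ℝ) * ε ^ (2 / 3 : ℝ)) ^ 6 = ε ^ 4 / c := by
  have hc6 : (c ^ (-(1 / 6) : ℝ)) ^ 6 = c⁻¹ := by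
    rw [← Real.rpow_mul_natCast hc, ← Real.rpow_neg_one]
    norm_num
  have hε6 : (ε ^ (2 / 3 : ℝ)) ^ 6 = ε ^ 4 := by
    rw [← Real.rpow_mul_natCast hε, ← Real.rpow_natCast ε]
    norm_num
  rw [mul_pow, hc6, hε6, div_eq_inv_mul]

/-- The constant in the counting estimate for simplices. -/
def countConst (k d : ℕ) : ℝ := k * √(1 + d * 2 ^ d + chordConst d * d) + 2 * d

theorem two_le_countConst (k : ℕ) (hd : 1 ≤ d) : 2 ≤ countConst k d := by
  have hd1 : (1 : ℝ) ≤ d := mod_cast hd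
  have hroot : 0 ≤ k * √(1 + d * 2 ^ d + chordConst d * d) := by positivity
  unfold countConst
  linarith

variable {X : ℝ}

theorem pow_four_le_pow_six (hc : 0 < c) (hc1 : c ≤ 1) (hX6 : X ^ 6 = ε ^ 4 / c) :
    ε ^ 4 ≤ X ^ 6 :=
  hX6 ▸ le_div_self (by positivity) hc hc1

theorem le_of_pow_six_eq (hc : 0 < c) (hc1 : c ≤ 1) (hε : 0 ≤ ε) (hε1 : ε ≤ 1) (hX : 0 ≤ X)
    (hX6 : X ^ 6 = ε ^ 4 / c) : ε ≤ X :=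
  le_of_pow_le_pow_left₀ (n := 6) (by norm_num) hX <|
    (pow_le_pow_of_le_one hε hε1 (by norm_num)).trans (pow_four_le_pow_six hc hc1 hX6)

theorem mul_le_of_pow_six_eq (hc : 0 < c) (hc1 : c ≤ 1) (hl : 0 ≤ l) (hle : l ≤ ε) (hR : 0 ≤ R)
    (hεR : ε * R ^ 3 ≤ 1) (hX : 0 ≤ X) (hX6 : X ^ 6 = ε ^ 4 / c) : l * R ≤ X := by
  have hε : 0 ≤ ε := hl.trans hle
  refine le_of_pow_le_pow_left₀ (n := 6) (by norm_num) hX ?_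
  calc (l * R) ^ 6 ≤ (ε * R) ^ 6 := by gcongr
    _ = ε ^ 4 * (ε * R ^ 3) ^ 2 := by ring
    _ ≤ ε ^ 4 := mul_le_of_le_one_right (by positivity) (pow_le_one₀ (by positivity) hεR)
    _ ≤ X ^ 6 := pow_four_le_pow_six hc hc1 hX6

theorem sqrt_le_of_pow_six_eq (d : ℕ) (hc : 0 < c) (hl : 0 < l) (hX : 0 ≤ X) (hX1 : X ≤ 1)
    (hX6 : X ^ 6 = ε ^ 4 / c) : √(d * (ε ^ 4 * l / 2) / (l * c)) ≤ d * X ^ 2 := by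
  refine Real.sqrt_le_iff.2 ⟨by positivity, ?_⟩
  have hdd : (d : ℝ) ≤ d ^ 2 := mod_cast Nat.le_self_pow two_ne_zero d
  calc d * (ε ^ 4 * l / 2) / (l * c) = d / 2 * X ^ 6 := by rw [hX6]; field_simp
    _ ≤ d ^ 2 * X ^ 4 := by
        gcongr ?_ * ?_
        · linarith [Nat.cast_nonneg (α := ℝ) d]
        · exact pow_le_pow_of_le_one hX hX1 (by norm_num)
    _ = (d * X ^ 2) ^ 2 := by ring

theorem balancedFormBound_le (d : ℕ) (hc : 0 < c) (hc1 : c ≤ 1) (hl : 0 < l) (hle : l ≤ ε)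
    (hε1 : ε ≤ 1) (hX : 0 ≤ X) (hX1 : X ≤ 1) (hX6 : X ^ 6 = ε ^ 4 / c) :
    balancedFormBound d c l ε (ε ^ 4 * l) ≤ √(1 + d * 2 ^ d + chordConst d * d) * X := by
  have hε : 0 ≤ ε := hl.le.trans hle
  have hchord := (chordConst_pos d).le
  have hεX : ε ≤ X := le_of_pow_six_eq hc hc1 hε hε1 hX hX6
  have hL : ε ^ 4 * l ≤ X ^ 2 :=
    calc ε ^ 4 * l ≤ ε ^ 4 := mul_le_of_le_one_right (by positivity) (hle.trans hε1)
      _ ≤ X ^ 6 := pow_four_le_pow_six hc hc1 hX6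
      _ ≤ X ^ 2 := pow_le_pow_of_le_one hX hX1 (by norm_num)
  refine Real.sqrt_le_iff.2 ⟨by positivity, ?_⟩
  calc ε ^ 2 + d * 2 ^ d * (ε ^ 4 * l) + chordConst d * √(d * (ε ^ 4 * l / 2) / (l * c))
      ≤ X ^ 2 + d * 2 ^ d * X ^ 2 + chordConst d * (d * X ^ 2) := by
        gcongr
        exact sqrt_le_of_pow_six_eq d hc hl hX hX1 hX6
    _ = (√(1 + d * 2 ^ d + chordConst d * d) * X) ^ 2 := by
        rw [mul_pow, Real.sq_sqrt (by positivity)]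
        ring

theorem abs_simplexCount_sub_pow_le_countConst (hd : k + 1 ≤ d) (hR : 0 ≤ R)
    (hvR : ∀ j, ‖v j‖ ≤ R) (hc : 0 < c) (hcv : c ≤ simplexWidth v) (hc1 : c ≤ 1) (hl : 0 < l)
    (hle : l ≤ ε) (hε1 : ε ≤ 1) (hεR : ε * R ^ 3 ≤ 1) (hA : MeasurableSet A)
    (hu : IsUniformlyDistributed ε (ε ^ 4 * l) A) :
    |simplexCount A v l - volume.real A ^ (k + 1)| ≤
      countConst k d * (c ^ (-(1 / 6) : ℝ) * ε ^ (2 / 3 : ℝ)) := by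
  have hε : 0 < ε := hl.trans_le hle
  have hX6 := rpow_mul_rpow_pow_six hc.le hε.le
  have hX : 0 ≤ c ^ (-(1 / 6) : ℝ) * ε ^ (2 / 3 : ℝ) := by positivity
  generalize c ^ (-(1 / 6) : ℝ) * ε ^ (2 / 3 : ℝ) = X at hX6 hX ⊢
  rcases le_or_gt X 1 with hX1 | hX1
  · have hL1 : ε ^ 4 * l ≤ 1 :=
      mul_le_one₀ (pow_le_one₀ hε.le hε1) hl.le (hle.trans hε1)
    calc |simplexCount A v l - volume.real A ^ (k + 1)|
        ≤ k * balancedFormBound d c l ε (ε ^ 4 * l) + d * (2 * (l * R)) :=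
          abs_simplexCount_sub_pow_le hd hR hvR hc hcv hl hA (by positivity) hL1 hu
      _ ≤ k * (√(1 + d * 2 ^ d + chordConst d * d) * X) + d * (2 * X) := by
          gcongr
          · exact balancedFormBound_le d hc hc1 hl hle hε1 hX hX1 hX6
          · exact mul_le_of_pow_six_eq hc hc1 hl.le hle hR hεR hX hX6
      _ = countConst k d * X := by
          unfold countConst
          ring
  · calc |simplexCount A v l - volume.real A ^ (k + 1)|
        ≤ |simplexCount A v l| + |volume.real A ^ (k + 1)| := abs_sub _ _
      _ ≤ 1 + 1 := by
          refine add_le_add (abs_simplexCount_le_one v l hA hu.1) ?_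
          rw [abs_of_nonneg (pow_nonneg measureReal_nonneg _)]
          exact pow_le_one₀ measureReal_nonneg (volume_real_le_one hu.1)
      _ ≤ countConst k d * X := by
          have := two_le_countConst k (show 1 ≤ d by omega)
          nlinarith

end CountingEstimate

/-! ### Sets of positive upper Banach density -/

section Rescaling

variable {d : ℕ} {A : Set (E d)} {t : E d} {N L : ℝ}

theorem indicator_sq_cubeDensity_sub_le (hAQ : A ⊆ unitCube d) (hL : 0 ≤ L) {G : ℝ}
    (hαG : volume.real A ≤ G) (hG : ∀ x, cubeDensity A x L ≤ G) (x : E d) :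
    (unitCube d).indicator (fun x => |cubeDensity A x L - volume.real A| ^ 2) x ≤
      (unitCube d).indicator (fun _ => 2 * G - volume.real A) x - cubeDensity A x L +
        (boundaryShell d L).indicator (fun _ => (1 : ℝ)) x := by
  obtain ⟨hg0, hg1⟩ := cubeDensity_mem_Icc A x L
  have hα0 : 0 ≤ volume.real A := measureReal_nonneg
  have hα1 := volume_real_le_one hAQ
  have hS := (indicator_one_mem_Icc (boundaryShell d L) x).1
  by_cases hxQ : x ∈ unitCube d
  · rw [indicator_of_mem hxQ, indicator_of_mem hxQ]
    have habs : |cubeDensity A x L - volume.real A| ≤ 2 * G - volume.real A - cubeDensity A x L :=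
      abs_le.2 ⟨by linarith, by linarith [hG x]⟩
    have hsq : |cubeDensity A x L - volume.real A| ^ 2 ≤ |cubeDensity A x L - volume.real A| :=
      pow_le_of_le_one (abs_nonneg _) (abs_le.2 ⟨by linarith, by linarith⟩) two_ne_zero
    linarith
  rw [indicator_of_notMem hxQ, indicator_of_notMem hxQ]
  by_cases hout : x ∈ cube (cubeCenter d) (1 + L)
  · have hin : x ∉ cube (cubeCenter d) (1 - L) := fun hin =>
      hxQ (unitCube_eq_cube d ▸ cube_subset_cube _ (by linarith) hin)
    rw [indicator_of_mem (show x ∈ boundaryShell d L from ⟨hout, hin⟩)]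
    linarith
  · rw [cubeDensity_eq_zero hAQ hout]
    linarith

/-- Since the densities average to `|A|`, up to boundary effects, their `L¹` deviation from `|A|` is
twice that of the positive part, which is at most `G - |A|`. -/
theorem integral_sq_cubeDensity_sub_le (hA : MeasurableSet A) (hAQ : A ⊆ unitCube d) (hL : 0 < L)
    (hL1 : L ≤ 1) {G : ℝ} (hαG : volume.real A ≤ G) (hG : ∀ x, cubeDensity A x L ≤ G) :
    ∫ x in unitCube d, |cubeDensity A x L - volume.real A| ^ 2 ≤
      2 * (G - volume.real A) + d * 2 ^ d * L := by
  have hQ := measurableSet_unitCube d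
  have hintQ : Integrable ((unitCube d).indicator fun _ => 2 * G - volume.real A) :=
    (integrable_indicator_iff hQ).2 (integrableOn_const (by simp [volume_unitCube]))
  have hintg := (isUnitBounded_cubeDensity hA hAQ hL).integrable
  have hintS := integrable_indicator_boundaryShell d L
  have hintQg : Integrable fun x =>
      (unitCube d).indicator (fun _ => 2 * G - volume.real A) x - cubeDensity A x L :=
    hintQ.sub hintg
  calc ∫ x in unitCube d, |cubeDensity A x L - volume.real A| ^ 2
      = ∫ x, (unitCube d).indicator (fun x => |cubeDensity A x L - volume.real A| ^ 2) x :=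
        (integral_indicator hQ).symm
    _ ≤ ∫ x, ((unitCube d).indicator (fun _ => 2 * G - volume.real A) x - cubeDensity A x L +
          (boundaryShell d L).indicator (fun _ => (1 : ℝ)) x) :=
        integral_mono (integrable_indicator_sq_cubeDensity_sub hA hAQ hL)
          (hintQg.add hintS) (indicator_sq_cubeDensity_sub_le hAQ hL.le hαG hG)
    _ = 2 * (G - volume.real A) + volume.real (boundaryShell d L) := by
        rw [integral_add hintQg hintS, integral_sub hintQ hintg,
          integral_cubeDensity hA hAQ hL, integral_indicator_const _ hQ,
          integral_indicator_const _ (measurableSet_boundaryShell d L), measureReal_def,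
          volume_unitCube, ENNReal.toReal_one, smul_eq_mul, smul_eq_mul]
        ring
    _ ≤ 2 * (G - volume.real A) + d * 2 ^ d * L := by
        gcongr
        exact volume_real_boundaryShell_le d hL.le hL1

/-- The similarity that maps `[0,1]^d` onto the cube of side `N` centred at `t`. -/
def blowUp (t : E d) (N : ℝ) (x : E d) : E d := N • (x - cubeCenter d) + t

theorem measurable_blowUp (t : E d) (N : ℝ) : Measurable (blowUp t N) := by
  unfold blowUp
  fun_prop

theorem volume_real_preimage_blowUp (t : E d) (hN : 0 < N) (S : Set (E d)) :
    volume.real (blowUp t N ⁻¹' S) = volume.real S / N ^ d := by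
  have hpre : blowUp t N ⁻¹' S = (fun x : E d => x + -cubeCenter d) ⁻¹'
      ((fun x : E d => N • x) ⁻¹' ((fun x : E d => x + t) ⁻¹' S)) := by
    ext x
    simp only [mem_preimage, blowUp, sub_eq_add_neg]
  rw [hpre, Measure.real, measure_preimage_add_right, Measure.addHaar_preimage_smul _ hN.ne',
    measure_preimage_add_right, ENNReal.toReal_mul, finrank_euclideanSpace_fin,
    ENNReal.toReal_ofReal (abs_nonneg _), abs_of_pos (by positivity), Measure.real, div_eq_inv_mul]

theorem preimage_blowUp_cube (t s : E d) (hN : 0 < N) (L : ℝ) :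
    blowUp t N ⁻¹' cube (blowUp t N s) (N * L) = cube s L := by
  ext x
  refine forall_congr' fun i => ?_
  have hcoord : blowUp t N x i - blowUp t N s i = N * (x i - s i) := by
    simp only [blowUp, PiLp.add_apply, PiLp.smul_apply, PiLp.sub_apply, smul_eq_mul]
    ring
  rw [hcoord, abs_mul, abs_of_pos hN, mul_div_assoc, mul_le_mul_iff_right₀ hN]

theorem preimage_blowUp_cube_self (t : E d) (hN : 0 < N) :
    blowUp t N ⁻¹' cube t N = unitCube d := by
  have hcenter : blowUp t N (cubeCenter d) = t := by
    rw [blowUp, sub_self, smul_zero, zero_add]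
  rw [unitCube_eq_cube, ← preimage_blowUp_cube t (cubeCenter d) hN, hcenter, mul_one]

/-- The part of `A` in the cube of side `N` centred at `t`, rescaled to a subset of `[0,1]^d`. -/
def rescaledWindow (A : Set (E d)) (t : E d) (N : ℝ) : Set (E d) := blowUp t N ⁻¹' (A ∩ cube t N)

theorem measurableSet_rescaledWindow (hA : MeasurableSet A) (t : E d) (N : ℝ) :
    MeasurableSet (rescaledWindow A t N) :=
  measurable_blowUp t N (hA.inter (measurableSet_cube t N))

theorem rescaledWindow_subset_unitCube (A : Set (E d)) (t : E d) (hN : 0 < N) :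
    rescaledWindow A t N ⊆ unitCube d :=
  preimage_blowUp_cube_self t hN ▸ preimage_mono inter_subset_right

theorem volume_real_rescaledWindow (A : Set (E d)) (t : E d) (hN : 0 < N) :
    volume.real (rescaledWindow A t N) = cubeDensity A t N := by
  rw [rescaledWindow, volume_real_preimage_blowUp t hN, cubeDensity, volume_real_cube 0 hN.le]

theorem cubeDensity_rescaledWindow_le (A : Set (E d)) (t s : E d) (hN : 0 < N) (hL : 0 ≤ L) :
    cubeDensity (rescaledWindow A t N) s L ≤ cubeDensity A (blowUp t N s) (N * L) := by
  have hsub : rescaledWindow A t N ∩ cube s L ⊆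
      blowUp t N ⁻¹' (A ∩ cube (blowUp t N s) (N * L)) := by
    rw [preimage_inter, preimage_blowUp_cube t s hN]
    exact inter_subset_inter_left _ (preimage_mono inter_subset_left)
  have hfin : volume (blowUp t N ⁻¹' (A ∩ cube (blowUp t N s) (N * L))) ≠ ∞ :=
    measure_ne_top_of_subset (preimage_mono inter_subset_right)
      (by simpa only [preimage_blowUp_cube t s hN] using volume_cube_ne_top s L)
  rw [cubeDensity, cubeDensity, volume_real_cube 0 hL, volume_real_cube 0 (mul_nonneg hN.le hL),
    mul_pow, ← div_div, ← volume_real_preimage_blowUp t hN]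
  exact div_le_div_of_nonneg_right (measureReal_mono hsub hfin) (by positivity)

theorem isUniformlyDistributed_rescaledWindow {ε δ η : ℝ} (hA : MeasurableSet A) (hN : 0 < N)
    (hL : 0 < L) (hL1 : L ≤ 1) (hlow : δ - η ≤ cubeDensity A t N)
    (hup : cubeDensity A t N ≤ δ + η) (hupL : ∀ s, cubeDensity A s (N * L) ≤ δ + η)
    (hε : 4 * η + d * 2 ^ d * L ≤ ε ^ 2) :
    IsUniformlyDistributed ε L (rescaledWindow A t N) := by
  have hQ := rescaledWindow_subset_unitCube A t hN
  have hα := volume_real_rescaledWindow A t hN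
  refine ⟨hQ, (integral_sq_cubeDensity_sub_le (measurableSet_rescaledWindow hA t N) hQ hL hL1
    (hα.trans_le hup) fun s =>
      (cubeDensity_rescaledWindow_le A t s hN hL.le).trans (hupL _)).trans ?_⟩
  rw [hα]
  linarith

theorem ContainsCopy.of_rescaledWindow {l : ℝ} {Δ : Set (E d)}
    (h : ContainsCopy (rescaledWindow A t N) l Δ) : ContainsCopy A (N * l) Δ := by
  obtain ⟨x, U, hxU⟩ := h
  refine ⟨blowUp t N x, U, ?_⟩
  rintro _ ⟨p, hp, rfl⟩
  have hmem : blowUp t N (x + l • rot U p) ∈ A := (hxU ⟨p, hp, rfl⟩).1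
  have himage : blowUp t N (x + l • rot U p) = blowUp t N x + (N * l) • rot U p := by
    unfold blowUp
    module
  rwa [himage] at hmem

end Rescaling

section UpperBanachDensity

variable {d : ℕ} {A : Set (E d)}

theorem upperBanachDensity_congr {B : Set (E d)} (h : A =ᵐ[volume] B) :
    upperBanachDensity A = upperBanachDensity B := by
  have hcube (t : E d) (N : ℝ) : volume (A ∩ cube t N) = volume (B ∩ cube t N) :=
    measure_congr (h.inter (ae_eq_refl _))
  simp only [upperBanachDensity, hcube]

theorem volume_inter_cube_div_le_one (A : Set (E d)) (t : E d) (N : ℝ) :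
    volume (A ∩ cube t N) / volume (cube (0 : E d) N) ≤ 1 := by
  refine ENNReal.div_le_of_le_mul ((measure_mono inter_subset_right).trans_eq ?_)
  rw [one_mul, volume_cube, volume_cube]

theorem toReal_volume_inter_cube_div (A : Set (E d)) (t : E d) (N : ℝ) :
    (volume (A ∩ cube t N) / volume (cube (0 : E d) N)).toReal = cubeDensity A t N :=
  ENNReal.toReal_div _ _

theorem upperBanachDensity_ne_top (A : Set (E d)) : upperBanachDensity A ≠ ∞ := by
  refine ((limsup_le_of_le (by isBoundedDefault) (.of_forall fun N => ?_)).trans_lt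
    ENNReal.one_lt_top).ne
  exact iSup_le fun t => volume_inter_cube_div_le_one A t N

theorem exists_forall_cubeDensity_le {β : ℝ} (hβ : 0 ≤ β)
    (h : upperBanachDensity A < ENNReal.ofReal β) :
    ∃ M : ℝ, 0 < M ∧ ∀ N, M ≤ N → ∀ t, cubeDensity A t N ≤ β := by
  obtain ⟨M, hM⟩ := eventually_atTop.1 (eventually_lt_of_limsup_lt h)
  refine ⟨max M 1, by positivity, fun N hN t => ?_⟩
  rw [← toReal_volume_inter_cube_div]
  exact ENNReal.toReal_le_of_le_ofReal hβ
    ((le_iSup_iff.2 fun _ hb => hb t).trans (hM N ((le_max_left _ _).trans hN)).le)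

theorem exists_le_cubeDensity {β : ℝ} (h : ENNReal.ofReal β < upperBanachDensity A) (N₀ : ℝ) :
    ∃ N, N₀ ≤ N ∧ ∃ t, β ≤ cubeDensity A t N := by
  obtain ⟨N, hN, hlt⟩ :=
    frequently_atTop.1 (frequently_lt_of_lt_limsup (by isBoundedDefault) h) N₀
  obtain ⟨t, ht⟩ := lt_iSup_iff.1 hlt
  refine ⟨N, hN, t, ?_⟩
  rw [← toReal_volume_inter_cube_div]
  exact (ENNReal.ofReal_le_iff_le_toReal
    ((volume_inter_cube_div_le_one A t N).trans_lt ENNReal.one_lt_top).ne).1 ht.le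

/-- A window of density close to the upper Banach density is uniformly distributed at every large
scale, because no cube at that scale can be much denser than the window. -/
theorem exists_isUniformlyDistributed_rescaledWindow (hA : MeasurableSet A)
    (hpos : 0 < upperBanachDensity A) {ε : ℝ} (hε : 0 < ε) (hε1 : ε ≤ 1) :
    ∃ l₀ : ℝ, 0 < l₀ ∧ ∀ l, l₀ ≤ l → ∃ (N : ℝ) (t : E d), 0 < N ∧ l / N ≤ ε ∧
      (upperBanachDensity A).toReal / 2 ≤ volume.real (rescaledWindow A t N) ∧
      IsUniformlyDistributed ε (ε ^ 4 * (l / N)) (rescaledWindow A t N) := by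
  have hfin := upperBanachDensity_ne_top A
  have hδ : 0 < (upperBanachDensity A).toReal := ENNReal.toReal_pos hpos.ne' hfin
  have hδA := ENNReal.ofReal_toReal hfin
  generalize (upperBanachDensity A).toReal = δ at hδ hδA ⊢
  obtain ⟨η, hη, hηε, hηδ⟩ : ∃ η, 0 < η ∧ η ≤ ε ^ 2 / 8 ∧ η ≤ δ / 2 :=
    ⟨min (ε ^ 2 / 8) (δ / 2), by positivity, min_le_left _ _, min_le_right _ _⟩
  obtain ⟨M, hM, hup⟩ := exists_forall_cubeDensity_le (A := A) (β := δ + η) (by positivity)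
    (hδA ▸ (ENNReal.ofReal_lt_ofReal_iff (by positivity)).2 (by linarith))
  refine ⟨M / ε ^ 4, by positivity, fun l hl => ?_⟩
  have hMl : M ≤ ε ^ 4 * l := (div_le_iff₀' (by positivity)).1 hl
  have hl0 : 0 < l := pos_of_mul_pos_right (hM.trans_le hMl) (by positivity)
  obtain ⟨N, hN, t, hlow⟩ := exists_le_cubeDensity (A := A) (β := δ - η)
    (hδA ▸ (ENNReal.ofReal_lt_ofReal_iff hδ).2 (by linarith)) (l * (1 + 2 * (d * 2 ^ d)) / ε)
  rw [div_le_iff₀ hε] at hN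
  have hd0 : 0 ≤ l * (d * 2 ^ d) := by positivity
  have hN0 : 0 < N := pos_of_mul_pos_left (lt_of_lt_of_le (by positivity) hN) hε.le
  have hlN : l / N ≤ ε := (div_le_iff₀ hN0).2 (by linarith)
  have hMN : M ≤ N :=
    calc M ≤ ε ^ 4 * l := hMl
      _ ≤ l := mul_le_of_le_one_left hl0.le (pow_le_one₀ hε.le hε1)
      _ ≤ N := (div_le_one hN0).1 (hlN.trans hε1)
  have hshell : d * 2 ^ d * (l / N) ≤ 1 / 2 := by
    rw [← mul_div_assoc, div_le_iff₀ hN0]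
    nlinarith
  refine ⟨N, t, hN0, hlN, ?_, isUniformlyDistributed_rescaledWindow hA hN0 (by positivity)
    (mul_le_one₀ (pow_le_one₀ hε.le hε1) (by positivity) (hlN.trans hε1)) hlow (hup N hMN t)
    (fun s => hup _ ?_ s) ?_⟩
  · rw [volume_real_rescaledWindow A t hN0]
    linarith
  · rwa [mul_left_comm, mul_div_cancel₀ _ hN0.ne']
  · have hε42 : ε ^ 4 ≤ ε ^ 2 := pow_le_pow_of_le_one hε.le hε1 (by norm_num)
    nlinarith [mul_le_mul_of_nonneg_left hshell (pow_nonneg hε.le 4)]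

theorem exists_countConst_mul_lt (k d : ℕ) (c R : ℝ) {τ : ℝ} (hτ : 0 < τ) :
    ∃ ε : ℝ, 0 < ε ∧ ε ≤ 1 ∧ ε * R ^ 3 ≤ 1 ∧
      countConst k d * (c ^ (-(1 / 6) : ℝ) * ε ^ (2 / 3 : ℝ)) < τ := by
  have hpow : Continuous fun ε : ℝ => countConst k d * (c ^ (-(1 / 6) : ℝ) * ε ^ (2 / 3 : ℝ)) :=
    ((Real.continuous_rpow_const (by norm_num)).const_mul _).const_mul _
  have hmul : Continuous fun ε : ℝ => ε * R ^ 3 := by fun_prop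
  have hcount : ∀ᶠ ε in 𝓝[>] (0 : ℝ),
      countConst k d * (c ^ (-(1 / 6) : ℝ) * ε ^ (2 / 3 : ℝ)) < τ :=
    ((hpow.tendsto' 0 0 (by norm_num)).eventually_lt_const hτ).filter_mono nhdsWithin_le_nhds
  have hR : ∀ᶠ ε in 𝓝[>] (0 : ℝ), ε * R ^ 3 < 1 :=
    ((hmul.tendsto' 0 0 (zero_mul _)).eventually_lt_const one_pos).filter_mono nhdsWithin_le_nhds
  have hunit : ∀ᶠ ε in 𝓝[>] (0 : ℝ), ε ∈ Ioc (0 : ℝ) 1 := Ioc_mem_nhdsGT one_pos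
  obtain ⟨ε, hcount, hR, hε, hε1⟩ := (hcount.and (hR.and hunit)).exists
  exact ⟨ε, hε, hε1, hR.le, hcount⟩

theorem exists_containsCopy_of_upperBanachDensity_pos {k : ℕ} (hk : 1 ≤ k) (hd : k + 1 ≤ d)
    {v : Fin k → E d} (hv : LinearIndependent ℝ v) (hA : MeasurableSet A)
    (hpos : 0 < upperBanachDensity A) :
    ∃ l₀ : ℝ, 0 < l₀ ∧ ∀ l : ℝ, l₀ ≤ l → ContainsCopy A l (simplex v) := by
  have hδ := ENNReal.toReal_pos hpos.ne' (upperBanachDensity_ne_top A)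
  have hvR (j : Fin k) : ‖v j‖ ≤ ∑ i, ‖v i‖ :=
    Finset.single_le_sum (fun i _ => norm_nonneg (v i)) (Finset.mem_univ j)
  obtain ⟨ε, hε, hε1, hεR, hsmall⟩ := exists_countConst_mul_lt k d (min (simplexWidth v) 1)
    (∑ i, ‖v i‖) (by positivity : 0 < ((upperBanachDensity A).toReal / 2) ^ (k + 1))
  obtain ⟨l₀, hl₀, hwindow⟩ := exists_isUniformlyDistributed_rescaledWindow hA hpos hε hε1
  refine ⟨l₀, hl₀, fun l hl => ?_⟩
  obtain ⟨N, t, hN, hlN, hdens, hu⟩ := hwindow l hl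
  have hcount := abs_simplexCount_sub_pow_le_countConst hd (by positivity) hvR
    (lt_min (simplexWidth_pos hk hv) one_pos) (min_le_left _ _) (min_le_right _ _)
    (div_pos (hl₀.trans_le hl) hN) hlN hε1 hεR (measurableSet_rescaledWindow hA t N) hu
  have hcopy := containsCopy_of_abs_simplexCount_sub_pow_lt hd
    ((hcount.trans_lt hsmall).trans_le (pow_le_pow_left₀ (by positivity) hdens _))
  simpa only [mul_div_cancel₀ l hN.ne'] using hcopy.of_rescaledWindow

end UpperBanachDensity

end Simplices

end

theorem mainTheorem3 (k d : ℕ) (hk : 1 ≤ k) (hd : k + 1 ≤ d) :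
    (∃ C : ℝ, 0 < C ∧ ∀ R : ℝ, 0 < R → ∃ ε₀ : ℝ, 0 < ε₀ ∧
      ∀ v : Fin k → Simplices.E d, LinearIndependent ℝ v →
        (∀ j, ‖v j‖ ≤ R) → Simplices.simplexWidth v ≤ 1 →
      ∀ ε l : ℝ, 0 < l → l ≤ ε → ε ≤ ε₀ →
      ∀ A : Set (Simplices.E d), NullMeasurableSet A volume → 0 < volume.real A →
        Simplices.IsUniformlyDistributed ε (ε ^ 4 * l) A →
        |Simplices.simplexCount A v l - volume.real A ^ (k + 1)| ≤
            C * (Simplices.simplexWidth v ^ (-(1 / 6) : ℝ) * ε ^ (2 / 3 : ℝ)) ∧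
        (C * (Simplices.simplexWidth v ^ (-(1 / 6) : ℝ) * ε ^ (2 / 3 : ℝ)) <
            volume.real A ^ (k + 1) →
          Simplices.ContainsCopy A l (Simplices.simplex v))) ∧
    (∀ v : Fin k → Simplices.E d, LinearIndependent ℝ v →
      ∀ A : Set (Simplices.E d), NullMeasurableSet A volume →
        0 < Simplices.upperBanachDensity A →
        ∃ l₀ : ℝ, 0 < l₀ ∧ ∀ l : ℝ, l₀ ≤ l →
          Simplices.ContainsCopy A l (Simplices.simplex v)) := by
  refine ⟨⟨Simplices.countConst k d, ?_, fun R hR => ⟨min 1 (1 / R ^ 3), by positivity, ?_⟩⟩, ?_⟩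
  · exact two_pos.trans_le (Simplices.two_le_countConst k (le_of_add_le_right hd))
  · intro v hv hvR hc1 ε l hl hle hε A hA _ hu
    obtain ⟨B, hBA, hB, hBe⟩ := hA.exists_measurable_subset_ae_eq
    have hεR : ε * R ^ 3 ≤ 1 := (le_div_iff₀ (by positivity)).1 (hε.trans (min_le_right _ _))
    have hcount := Simplices.abs_simplexCount_sub_pow_le_countConst hd hR.le hvR
      (Simplices.simplexWidth_pos hk hv) le_rfl hc1 hl hle (hε.trans (min_le_left _ _)) hεR hB
      (hu.congr hBA hBe)
    rw [Simplices.simplexCount_congr v l hBe, measureReal_congr hBe] at hcount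
    exact ⟨hcount, fun hlt =>
      Simplices.containsCopy_of_abs_simplexCount_sub_pow_lt hd (hcount.trans_lt hlt)⟩
  · intro v hv A hA hpos
    obtain ⟨B, hBA, hB, hBe⟩ := hA.exists_measurable_subset_ae_eq
    rw [← Simplices.upperBanachDensity_congr hBe] at hpos
    obtain ⟨l₀, hl₀, hcopy⟩ :=
      Simplices.exists_containsCopy_of_upperBanachDensity_pos hk hd hv hB hpos
    exact ⟨l₀, hl₀, fun l hl => (hcopy l hl).mono hBA⟩
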